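/- Let $S$ be a finite semigroup and $k$ a commutative semiring with unit. For a (not necessarily unital) $k$-algebra $A$, a right $A$-module is a $k$-module $M$ with an associative $k$-bilinear right action of $A$; submodules and congruences are those compatible with $+$, with $k$ and with $A$. A congruence is proper if it has more than one class, and trivial if all its classes are singletons. A right $A$-module $M$ with $MA\neq 0$ is simple if every proper congruence on it is trivial, minimal if it has no proper non-zero submodule, and irreducible if it is both simple and minimal. "Maximal congruence" means maximal among proper congruences, "maximal submodule" means maximal among proper submodules, and "minimal submodule" means minimal among non-zero submodules. Write $J(s)=S^1sS^1$; the $\mathscr J$-class of $s$ is $\{t : J(t)=J(s)\}$, and it is regular if it contains an idempotent. For every regular $\mathscr J$-class $J$ fix an idempotent $e_J\in J$, let $G_J$ be the group of units of the monoid $e_JSe_J$, let $I_J=\{s\in S : J\not\subseteq J(s)\}$ (an ideal of $S$), and let $A_J=kS/kI_J$, where $x\equiv x' \bmod kI_J$ iff $x+n=x'+n'$ for some $n,n'\in kI_J$. A right $kS$-module $M$ has apex $J$ if $\{s\in S: Ms=0\}=I_J$. For a right $kG_J$-module $V$ define the right $kS$-modules $$\mathrm{Ind}_J(V)=V\otimes_{kG_J}e_JA_J,\qquad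 \mathrm{Coind}_J(V)=\mathrm{Hom}_{kG_J}(A_Je_J,V),$$ and put $$N=\{(u,v)\in \mathrm{Ind}_J(V)^2 : uae_J=vae_J\ \ \forall a\in A_J\},\qquad K=\{m\in \mathrm{Ind}_J(V): mae_J=0\ \ \forall a\in A_J\},$$ a congruence on, and a submodule of, $\mathrm{Ind}_J(V)$. Let $\mathrm{Coind}_J(V)e_JkS$ be the submodule of $\mathrm{Coind}_J(V)$ spanned by all $\varphi e_Ja$ with $\varphi\in\mathrm{Coind}_J(V)$, $a\in kS$. Then, for every regular $\mathscr J$-class $J$: 1. If $M$ is an irreducible (respectively minimal) $kS$-module with apex $J$, then $Me_J$ is an irreducible (respectively minimal) $kG_J$-module. 2. If $V$ is an irreducible $kG_J$-module, then $N$ is the unique maximal congruence on $\mathrm{Ind}_J(V)$, and $\mathrm{Ind}_J(V)/N$ is, up to isomorphism, the unique irreducible $kS$-module $M$ with apex $J$ such that $Me_J\cong V$. 3. If $V$ is an irreducible $kG_J$-module, then $\mathrm{Coind}_J(V)e_JkS$ is the unique minimal $kS$-submodule of $\mathrm{Coind}_J(V)$, and it is, up to isomorphism, the unique irreducible $kS$-module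 $M$ with apex $J$ such that $Me_J\cong V$. 4. If $V$ is a minimal $kG_J$-module, then $K$ is the unique maximal $kS$-submodule of $\mathrm{Ind}_J(V)$. Moreover, the minimal $kS$-modules $M$ with apex $J$ such that $Me_J\cong V$ are, up to isomorphism, exactly the quotients $\mathrm{Ind}_J(V)/R$ by congruences $R\subseteq N$ such that $K$ is contained in a single class of $R$. Consequently, the assignment $(J,V)\mapsto \mathrm{Ind}_J(V)/N\cong \mathrm{Coind}_J(V)e_JkS$ induces a bijection between the set of pairs consisting of a regular $\mathscr J$-class $J$ and an isomorphism class of irreducible $kG_J$-modules $V$, and the set of isomorphism classes of irreducible $kS$-modules. -/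

import Mathlib

open scoped TensorProduct

universe u v w x

noncomputable section

namespace SemiringRep

/-! ### Right modules over a (not necessarily unital) algebra over a commutative semiring -/

/-- A right module over the not necessarily unital `k`-algebra `A`: a `k`-module `M` with an
associative `k`-bilinear right action of `A`. The action is `act k m a`, i.e. `m a`. -/
class RightModule (k : Type*) (A : Type*) (M : Type*) [CommSemiring k]
    [NonUnitalSemiring A] [Module k A] [AddCommMonoid M] [Module k M] where
  /-- The action `(m, a) ↦ m a`. -/
  actHom : M →ₗ[k] A →ₗ[k] M
  actHom_mul : ∀ (m : M) (a b : A), actHom m (a * b) = actHom (actHom m a) b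

section RightModules

variable (k : Type*) [CommSemiring k] {A : Type*} [NonUnitalSemiring A] [Module k A]
variable {M : Type*} [AddCommMonoid M] [Module k M] [RightModule k A M]
variable {N : Type*} [AddCommMonoid N] [Module k N] [RightModule k A N]

/-- The action `m a`. -/
def act (m : M) (a : A) : M := RightModule.actHom (k := k) m a

theorem act_mul (m : M) (a b : A) : act k m (a * b) = act k (act k m a) b :=
  RightModule.actHom_mul m a b

theorem act_add (m : M) (a b : A) : act k m (a + b) = act k m a + act k m b := by
  simp [act]

theorem act_smul (m : M) (c : k) (a : A) : act k m (c • a) = c • act k m a := by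
  simp [act]

theorem add_act (m n : M) (a : A) : act k (m + n) a = act k m a + act k n a := by
  simp [act]

theorem smul_act (c : k) (m : M) (a : A) : act k (c • m) a = c • act k m a := by
  simp [act]

variable (A M)

/-- A submodule of the right `A`-module `M`. -/
structure RSub extends Submodule k M where
  act_mem : ∀ (m : M) (a : A), m ∈ toSubmodule → act k m a ∈ toSubmodule

/-- A congruence on the right `A`-module `M`. -/
structure RCon extends ModuleCon k M where
  act_rel : ∀ (m n : M) (a : A), toModuleCon.r m n → toModuleCon.r (act k m a) (act k n a)

instance : LE (RSub k A M) := ⟨fun W W' => W.toSubmodule ≤ W'.toSubmodule⟩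

instance : LE (RCon k A M) := ⟨fun R R' => ∀ m n : M, R.r m n → R'.r m n⟩

variable {k A M}

/-- A submodule is proper if it is not the whole module. -/
def RSub.IsProper (W : RSub k A M) : Prop := W.toSubmodule ≠ ⊤

/-- A submodule is non-zero. -/
def RSub.IsNonzero (W : RSub k A M) : Prop := W.toSubmodule ≠ ⊥

/-- A congruence is proper if it has more than one class. -/
def RCon.IsProper (R : RCon k A M) : Prop := ∃ m n : M, ¬ R.r m n

/-- A congruence is trivial if all its classes are singletons. -/
def RCon.IsTrivial (R : RCon k A M) : Prop := ∀ m n : M, R.r m n → m = n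

variable (k A M)

/-- `M A ≠ 0`. -/
def ActsNonzero : Prop := ∃ (m : M) (a : A), act k m a ≠ 0

/-- `M A ≠ 0` and `M` has no proper non-zero submodule. -/
def IsMinimalModule : Prop :=
  ActsNonzero k A M ∧ ∀ W : RSub k A M, W.IsProper → ¬ W.IsNonzero

/-- `M A ≠ 0` and every proper congruence on `M` is trivial. -/
def IsSimpleRightModule : Prop :=
  ActsNonzero k A M ∧ ∀ R : RCon k A M, R.IsProper → R.IsTrivial

/-- Irreducible modules: both simple and minimal. -/
def IsIrreducibleModule : Prop := IsSimpleRightModule k A M ∧ IsMinimalModule k A M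

variable (N)

/-- `M` and `N` are isomorphic right `A`-modules. -/
def Isomorphic : Prop :=
  ∃ f : M ≃ₗ[k] N, ∀ (m : M) (a : A), f (act k m a) = act k (f m) a

/-- `Hom_A(M, N)`. -/
def rHom : Submodule k (M →ₗ[k] N) where
  carrier := {f | ∀ (m : M) (a : A), f (act k m a) = act k (f m) a}
  add_mem' := by
    intro f g hf hg m a
    simp [hf m a, hg m a, add_act]
  zero_mem' := by
    intro m a
    simp [act]
  smul_mem' := by
    intro c f hf m a
    simp [hf m a, smul_act]

variable {k A M N}

/-- A submodule is itself a right `A`-module. -/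
instance RSub.instRightModule (W : RSub k A M) : RightModule k A W.toSubmodule where
  actHom := LinearMap.mk₂ k (fun m a => ⟨act k m.1 a, W.act_mem m.1 a m.2⟩)
    (fun m n a => Subtype.ext (add_act k m.1 n.1 a))
    (fun c m a => Subtype.ext (smul_act k c m.1 a))
    (fun m a b => Subtype.ext (act_add k m.1 a b))
    (fun c m a => Subtype.ext (act_smul k m.1 c a))
  actHom_mul m a b := Subtype.ext (act_mul k m.1 a b)

/-- The quotient of a right `A`-module by a congruence is a right `A`-module. -/
instance RCon.instRightModule (R : RCon k A M) : RightModule k A R.toModuleCon.Quotient where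
  actHom := LinearMap.mk₂ k
    (fun m a => Quotient.map (fun m => act k m a) (fun m n h => R.act_rel m n a h) m)
    (by rintro ⟨m⟩ ⟨n⟩ a; exact congrArg (Quotient.mk R.toSetoid) (add_act k m n a))
    (by rintro c ⟨m⟩ a; exact congrArg (Quotient.mk R.toSetoid) (smul_act k c m a))
    (by rintro ⟨m⟩ a b; exact congrArg (Quotient.mk R.toSetoid) (act_add k m a b))
    (by rintro c ⟨m⟩ a; exact congrArg (Quotient.mk R.toSetoid) (act_smul k m c a))
  actHom_mul := by
    rintro ⟨m⟩ a b
    exact congrArg (Quotient.mk R.toSetoid) (act_mul k m a b)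

theorem Isomorphic.refl : Isomorphic k A M M := ⟨LinearEquiv.refl k M, fun _ _ => rfl⟩

theorem Isomorphic.symm (h : Isomorphic k A M N) : Isomorphic k A N M := by
  obtain ⟨f, hf⟩ := h
  refine ⟨f.symm, fun n a => ?_⟩
  rw [LinearEquiv.symm_apply_eq, hf, LinearEquiv.apply_symm_apply]

theorem Isomorphic.trans {P : Type*} [AddCommMonoid P] [Module k P] [RightModule k A P]
    (h : Isomorphic k A M N) (h' : Isomorphic k A N P) : Isomorphic k A M P := by
  obtain ⟨f, hf⟩ := h
  obtain ⟨g, hg⟩ := h'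
  exact ⟨f.trans g, fun m a => by simp [hf, hg]⟩

end RightModules

/-! ### Isomorphism classes of modules -/

section Classes

variable (k : Type u) [CommSemiring k] (A : Type v) [NonUnitalSemiring A] [Module k A]

/-- A bundled right `A`-module, with underlying set in `Type w`. -/
structure RMod where
  carrier : Type w
  [addCommMonoid : AddCommMonoid carrier]
  [module : Module k carrier]
  [rightModule : RightModule k A carrier]

attribute [instance] RMod.addCommMonoid RMod.module RMod.rightModule

/-- The setoid of isomorphism of right `A`-modules. -/
instance RMod.isoSetoid : Setoid (RMod.{u, v, w} k A) where
  r M N := Isomorphic k A M.carrier N.carrier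
  iseqv := ⟨fun _ => Isomorphic.refl, Isomorphic.symm, Isomorphic.trans⟩

/-- Isomorphism classes of right `A`-modules in `Type w`. -/
def IsoClass : Type (max u v (w + 1)) := Quotient (RMod.isoSetoid.{u, v, w} k A)

/-- The isomorphism class of `M`. -/
def isoClass (M : Type w) [AddCommMonoid M] [Module k M] [RightModule k A M] :
    IsoClass.{u, v, w} k A := Quotient.mk _ (RMod.mk M)

/-- Isomorphism classes of irreducible right `A`-modules in `Type w`. -/
def IrrClass : Type (max u v (w + 1)) :=
  {c : IsoClass.{u, v, w} k A //
    ∃ M : RMod.{u, v, w} k A, IsIrreducibleModule k A M.carrier ∧ isoClass k A M.carrier = c}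

/-- The isomorphism class of an irreducible module. -/
def irrClass (M : Type w) [AddCommMonoid M] [Module k M] [RightModule k A M]
    (h : IsIrreducibleModule k A M) : IrrClass.{u, v, w} k A :=
  ⟨isoClass k A M, RMod.mk M, h, rfl⟩

end Classes

/-! ### Regular `𝒥`-classes and maximal subgroups -/

section Semigroup

variable {S : Type*} [Semigroup S]

/-- The principal two-sided ideal `S¹ s S¹`. -/
def principalIdeal (s : S) : Set S :=
  {t | ∃ p q : WithOne S, (t : WithOne S) = p * (s : WithOne S) * q}

/-- Green's relation `𝒥`. -/
def JRel (s t : S) : Prop := principalIdeal s = principalIdeal t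

variable (S) in
/-- The regular `𝒥`-classes of `S`: those `𝒥`-classes that contain an idempotent. -/
def RegJClass : Type _ :=
  {J : Set S // (∃ s, J = {t | JRel s t}) ∧ ∃ e ∈ J, IsIdempotentElem e}

/-- The ideal of all `s` with `J ⊄ S¹ s S¹`. -/
def notAbove (J : Set S) : Set S := {s | ¬ J ⊆ principalIdeal s}

theorem self_mem_principalIdeal (s : S) : s ∈ principalIdeal s := ⟨1, 1, by simp⟩

theorem principalIdeal_mul_left (s t : S) : principalIdeal (t * s) ⊆ principalIdeal s := by
  rintro r ⟨p, q, h⟩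
  exact ⟨p * t, q, by rw [h]; simp [mul_assoc]⟩

theorem principalIdeal_mul_right (s t : S) : principalIdeal (s * t) ⊆ principalIdeal s := by
  rintro r ⟨p, q, h⟩
  exact ⟨p, t * q, by rw [h]; simp [mul_assoc]⟩

theorem mul_mem_notAbove_left {J : Set S} (t : S) {s : S} (h : s ∈ notAbove J) :
    t * s ∈ notAbove J := fun h' => h (h'.trans (principalIdeal_mul_left s t))

theorem mul_mem_notAbove_right {J : Set S} (t : S) {s : S} (h : s ∈ notAbove J) :
    s * t ∈ notAbove J := fun h' => h (h'.trans (principalIdeal_mul_right s t))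

variable {e : S}

/-- The monoid `eSe`, with identity `e`. -/
def LocalMonoid (_ : IsIdempotentElem e) : Type _ := Subsemigroup.corner e

instance (he : IsIdempotentElem e) : Monoid (LocalMonoid he) where
  __ : Semigroup (LocalMonoid he) := inferInstanceAs (Semigroup (Subsemigroup.corner e))
  one := ⟨e, e, by simp only [he.eq]⟩
  one_mul r := Subtype.ext ((Subsemigroup.mem_corner_iff he).mp r.2).1
  mul_one r := Subtype.ext ((Subsemigroup.mem_corner_iff he).mp r.2).2

/-- The maximal subgroup `G_e`: the group of units of `eSe`. -/
abbrev MaxSubgroup (he : IsIdempotentElem e) : Type _ := (LocalMonoid he)ˣ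

/-- The inclusion `G_e → S`. -/
def groupIncl (he : IsIdempotentElem e) : MaxSubgroup he →ₙ* S where
  toFun g := g.1.1
  map_mul' _ _ := rfl

theorem mul_groupIncl (he : IsIdempotentElem e) (g : MaxSubgroup he) :
    e * groupIncl he g = groupIncl he g := ((Subsemigroup.mem_corner_iff he).mp g.1.2).1

theorem groupIncl_mul (he : IsIdempotentElem e) (g : MaxSubgroup he) :
    groupIncl he g * e = groupIncl he g := ((Subsemigroup.mem_corner_iff he).mp g.1.2).2

end Semigroup

/-! ### The algebra `A_J = kS / k(notAbove J)` -/

section Algebra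

/-- The congruence modulo a submodule: `m ≡ m'` iff `m + n = m' + n'` for some `n, n'` in it. -/
def modCon {k M : Type*} [CommSemiring k] [AddCommMonoid M] [Module k M] (N : Submodule k M) :
    ModuleCon k M where
  r m m' := ∃ n ∈ N, ∃ n' ∈ N, m + n = m' + n'
  iseqv :=
    { refl := fun _ => ⟨0, N.zero_mem, 0, N.zero_mem, rfl⟩
      symm := fun ⟨n, hn, n', hn', h⟩ => ⟨n', hn', n, hn, h.symm⟩
      trans := by
        rintro x y z ⟨n, hn, n', hn', h⟩ ⟨p, hp, p', hp', h'⟩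
        refine ⟨n + p, N.add_mem hn hp, p' + n', N.add_mem hp' hn', ?_⟩
        rw [← add_assoc, h, ← add_assoc, ← h']
        abel }
  add' := by
    rintro a b c d ⟨n, hn, n', hn', h⟩ ⟨p, hp, p', hp', h'⟩
    refine ⟨n + p, N.add_mem hn hp, n' + p', N.add_mem hn' hp', ?_⟩
    rw [add_add_add_comm, h, h', add_add_add_comm]
  smul := by
    rintro c x y ⟨n, hn, n', hn', h⟩
    exact ⟨c • n, N.smul_mem c hn, c • n', N.smul_mem c hn', by rw [← smul_add, h, smul_add]⟩

variable (k : Type*) [CommSemiring k] {S : Type*} [Semigroup S]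

/-- `k I ⊆ kS`, the `k`-span of the subset `I` of `S`. -/
def spanIn (I : Set S) : Submodule k (MonoidAlgebra k S) :=
  Submodule.span k ((fun s => MonoidAlgebra.single s (1 : k)) '' I)

theorem mul_mem_spanIn_left (J : Set S) (a : MonoidAlgebra k S) {b : MonoidAlgebra k S}
    (hb : b ∈ spanIn k (notAbove J)) : a * b ∈ spanIn k (notAbove J) := by
  induction hb using Submodule.span_induction with
  | mem b hb =>
    obtain ⟨s, hs, rfl⟩ := hb
    induction a using MonoidAlgebra.induction_linear with
    | zero => simp
    | add f g hf hg => rw [add_mul]; exact Submodule.add_mem _ hf hg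
    | single t c =>
      simp only [MonoidAlgebra.single_mul_single, mul_one]
      have h : MonoidAlgebra.single (t * s) c = c • MonoidAlgebra.single (t * s) (1 : k) := by simp
      rw [h]
      exact Submodule.smul_mem _ _
        (Submodule.subset_span ⟨t * s, mul_mem_notAbove_left t hs, rfl⟩)
  | zero => simp
  | add x y _ _ hx hy => rw [mul_add]; exact Submodule.add_mem _ hx hy
  | smul c x _ hx => rw [mul_smul_comm]; exact Submodule.smul_mem _ _ hx

theorem mul_mem_spanIn_right (J : Set S) (a : MonoidAlgebra k S) {b : MonoidAlgebra k S}
    (hb : b ∈ spanIn k (notAbove J)) : b * a ∈ spanIn k (notAbove J) := by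
  induction hb using Submodule.span_induction with
  | mem b hb =>
    obtain ⟨s, hs, rfl⟩ := hb
    induction a using MonoidAlgebra.induction_linear with
    | zero => simp
    | add f g hf hg => rw [mul_add]; exact Submodule.add_mem _ hf hg
    | single t c =>
      simp only [MonoidAlgebra.single_mul_single, one_mul]
      have h : MonoidAlgebra.single (s * t) c = c • MonoidAlgebra.single (s * t) (1 : k) := by simp
      rw [h]
      exact Submodule.smul_mem _ _
        (Submodule.subset_span ⟨s * t, mul_mem_notAbove_right t hs, rfl⟩)
  | zero => simp
  | add x y _ _ hx hy => rw [add_mul]; exact Submodule.add_mem _ hx hy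
  | smul c x _ hx => rw [smul_mul_assoc]; exact Submodule.smul_mem _ _ hx

/-- The quotient `A_J = kS / k(notAbove J)`. -/
def AJ (J : Set S) : Type _ := (modCon (spanIn k (notAbove J))).Quotient

variable (J : Set S)

instance : AddCommMonoid (AJ k J) :=
  inferInstanceAs (AddCommMonoid (modCon (spanIn k (notAbove J))).Quotient)

instance : Module k (AJ k J) :=
  inferInstanceAs (Module k (modCon (spanIn k (notAbove J))).Quotient)

/-- The class in `A_J` of an element of `kS`. -/
def toAJFun (a : MonoidAlgebra k S) : AJ k J :=
  Quotient.mk (modCon (spanIn k (notAbove J))).toSetoid a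

theorem toAJFun_surjective : Function.Surjective (toAJFun k J) := Quotient.mk_surjective

instance : Mul (AJ k J) where
  mul := Quotient.map₂ (· * ·) (by
    rintro a a' ⟨n, hn, n', hn', h⟩ b b' ⟨p, hp, p', hp', h'⟩
    refine ⟨a * p + n * (b + p), ?_, a' * p' + n' * (b' + p'), ?_, ?_⟩
    · exact Submodule.add_mem _ (mul_mem_spanIn_left k J _ hp) (mul_mem_spanIn_right k J _ hn)
    · exact Submodule.add_mem _ (mul_mem_spanIn_left k J _ hp') (mul_mem_spanIn_right k J _ hn')
    · calc a * b + (a * p + n * (b + p)) = (a + n) * (b + p) := by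
            rw [add_mul, mul_add a, add_assoc]
        _ = (a' + n') * (b' + p') := by rw [h, h']
        _ = a' * b' + (a' * p' + n' * (b' + p')) := by rw [add_mul, mul_add a', add_assoc])

theorem toAJFun_mul (a b : MonoidAlgebra k S) :
    toAJFun k J (a * b) = toAJFun k J a * toAJFun k J b := rfl

theorem toAJFun_add (a b : MonoidAlgebra k S) :
    toAJFun k J (a + b) = toAJFun k J a + toAJFun k J b := rfl

instance : NonUnitalSemiring (AJ k J) where
  left_distrib := by
    rintro ⟨a⟩ ⟨b⟩ ⟨c⟩; exact congrArg (toAJFun k J) (mul_add a b c)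
  right_distrib := by
    rintro ⟨a⟩ ⟨b⟩ ⟨c⟩; exact congrArg (toAJFun k J) (add_mul a b c)
  zero_mul := by rintro ⟨a⟩; exact congrArg (toAJFun k J) (zero_mul a)
  mul_zero := by rintro ⟨a⟩; exact congrArg (toAJFun k J) (mul_zero a)
  mul_assoc := by
    rintro ⟨a⟩ ⟨b⟩ ⟨c⟩; exact congrArg (toAJFun k J) (mul_assoc a b c)

instance : IsScalarTower k (AJ k J) (AJ k J) where
  smul_assoc := by
    rintro c ⟨a⟩ ⟨b⟩; exact congrArg (toAJFun k J) (smul_mul_assoc c a b)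

instance : SMulCommClass k (AJ k J) (AJ k J) where
  smul_comm := by
    rintro c ⟨a⟩ ⟨b⟩; exact congrArg (toAJFun k J) (mul_smul_comm c a b).symm

/-- The projection `kS → A_J`. -/
def toAJ : MonoidAlgebra k S →ₙₐ[k] AJ k J where
  toFun := toAJFun k J
  map_smul' _ _ := rfl
  map_zero' := rfl
  map_add' _ _ := rfl
  map_mul' _ _ := rfl

/-- Restriction of scalars from `A_J` to `kS`. -/
@[reducible]
def restrictToS (M : Type*) [AddCommMonoid M] [Module k M] [RightModule k (AJ k J) M] :
    RightModule k (MonoidAlgebra k S) M where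
  actHom := LinearMap.mk₂ k (fun m a => act k m (toAJ k J a))
    (fun m n a => add_act k m n _)
    (fun c m a => smul_act k c m _)
    (fun m a b => by rw [map_add, act_add])
    (fun c m a => by rw [map_smul, act_smul])
  actHom_mul m a b := by
    change act k m (toAJ k J (a * b)) = _
    rw [map_mul, act_mul]
    rfl

/-- The element `s` of `S` in `kS`. -/
def el (s : S) : MonoidAlgebra k S := MonoidAlgebra.single s 1

variable {e : S}

/-- The map `k G_e → kS`. -/
def inclS (he : IsIdempotentElem e) :
    MonoidAlgebra k (MaxSubgroup he) →ₙₐ[k] MonoidAlgebra k S :=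
  MonoidAlgebra.mapDomainNonUnitalAlgHom k k (groupIncl he)

theorem inclS_single (he : IsIdempotentElem e) (g : MaxSubgroup he) (c : k) :
    inclS k he (MonoidAlgebra.single g c) = MonoidAlgebra.single (groupIncl he g) c := by
  simp [inclS]

theorem el_mul_inclS (he : IsIdempotentElem e) (b : MonoidAlgebra k (MaxSubgroup he)) :
    el k e * inclS k he b = inclS k he b := by
  induction b using MonoidAlgebra.induction_linear with
  | zero => simp
  | add f g hf hg => rw [map_add, mul_add, hf, hg]
  | single g c =>
    rw [inclS_single, el, MonoidAlgebra.single_mul_single, one_mul, mul_groupIncl]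

theorem inclS_mul_el (he : IsIdempotentElem e) (b : MonoidAlgebra k (MaxSubgroup he)) :
    inclS k he b * el k e = inclS k he b := by
  induction b using MonoidAlgebra.induction_linear with
  | zero => simp
  | add f g hf hg => rw [map_add, add_mul, hf, hg]
  | single g c =>
    rw [inclS_single, el, MonoidAlgebra.single_mul_single, mul_one, groupIncl_mul]

/-- The map `k G_e → A_J`. -/
def inclA (he : IsIdempotentElem e) : MonoidAlgebra k (MaxSubgroup he) →ₙₐ[k] AJ k J :=
  (toAJ k J).comp (inclS k he)

variable (e) in
/-- The image of `e` in `A_J`. -/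
def elA : AJ k J := toAJ k J (el k e)

theorem elA_mul_inclA (he : IsIdempotentElem e) (b : MonoidAlgebra k (MaxSubgroup he)) :
    elA k J e * inclA k J he b = inclA k J he b := by
  change toAJ k J (el k e) * toAJ k J (inclS k he b) = toAJ k J (inclS k he b)
  rw [← map_mul, el_mul_inclS]

theorem inclA_mul_elA (he : IsIdempotentElem e) (b : MonoidAlgebra k (MaxSubgroup he)) :
    inclA k J he b * elA k J e = inclA k J he b := by
  change toAJ k J (inclS k he b) * toAJ k J (el k e) = toAJ k J (inclS k he b)
  rw [← map_mul, inclS_mul_el]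

variable (e) in
/-- `e A_J`. -/
def eA : Submodule k (AJ k J) := LinearMap.range (LinearMap.mulLeft k (elA k J e))

variable (e) in
/-- `A_J e`. -/
def Ae : Submodule k (AJ k J) := LinearMap.range (LinearMap.mulRight k (elA k J e))

/-- Right multiplication makes `e A_J` a right `A_J`-module. -/
instance : RightModule k (AJ k J) (eA k J e) where
  actHom := LinearMap.mk₂ k
    (fun z a => ⟨z.1 * a, by
      obtain ⟨y, hy⟩ := z.2
      exact ⟨y * a, by rw [← hy]; simp [mul_assoc]⟩⟩)
    (fun _ _ _ => Subtype.ext (add_mul _ _ _))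
    (fun _ _ _ => Subtype.ext (smul_mul_assoc _ _ _))
    (fun _ _ _ => Subtype.ext (mul_add _ _ _))
    (fun _ _ _ => Subtype.ext (mul_smul_comm _ _ _))
  actHom_mul _ _ _ := Subtype.ext (mul_assoc _ _ _).symm

/-- The left action of `k G_e` on `e A_J`, by multiplication. -/
def groupMul (he : IsIdempotentElem e) (b : MonoidAlgebra k (MaxSubgroup he)) (z : eA k J e) :
    eA k J e :=
  ⟨inclA k J he b * z.1, ⟨inclA k J he b * z.1, by
    simp only [LinearMap.mulLeft_apply]
    rw [← mul_assoc, elA_mul_inclA]⟩⟩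

/-- Right multiplication makes `A_J e` a right `k G_e`-module. -/
instance instRightModuleAe (he : IsIdempotentElem e) :
    RightModule k (MonoidAlgebra k (MaxSubgroup he)) (Ae k J e) where
  actHom := LinearMap.mk₂ k
    (fun z b => ⟨z.1 * inclA k J he b, ⟨z.1 * inclA k J he b, by
      simp only [LinearMap.mulRight_apply]
      rw [mul_assoc, inclA_mul_elA]⟩⟩)
    (fun _ _ _ => Subtype.ext (add_mul _ _ _))
    (fun _ _ _ => Subtype.ext (smul_mul_assoc _ _ _))
    (fun _ _ _ => Subtype.ext (by simp only [map_add, mul_add, Submodule.coe_add]))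
    (fun _ _ _ => Subtype.ext (by simp only [map_smul, mul_smul_comm, Submodule.coe_smul]))
  actHom_mul _ _ _ := Subtype.ext (by
    simp only [map_mul, LinearMap.mk₂_apply]
    exact (mul_assoc _ _ _).symm)

/-- The left action of `A_J` on `A_J e`, by multiplication. -/
def leftMulAe (a : AJ k J) : Ae k J e →ₗ[k] Ae k J e where
  toFun z := ⟨a * z.1, by
    obtain ⟨y, hy⟩ := z.2
    exact ⟨a * y, by rw [← hy]; simp [mul_assoc]⟩⟩
  map_add' _ _ := Subtype.ext (mul_add _ _ _)
  map_smul' _ _ := Subtype.ext (mul_smul_comm _ _ _)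

end Algebra

/-! ### Restriction, induction, coinduction -/

section Functors

variable (k : Type*) [CommSemiring k] {S : Type*} [Semigroup S] (J : Set S)
variable {e : S} (he : IsIdempotentElem e)

/-- `M e`, for a right `kS`-module `M`. -/
def resE (e : S) (M : Type*) [AddCommMonoid M] [Module k M]
    [RightModule k (MonoidAlgebra k S) M] : Submodule k M :=
  LinearMap.range
    ((RightModule.actHom (k := k) (A := MonoidAlgebra k S) (M := M)).flip (el k e))

/-- `M e` is a right `k G_e`-module. -/
instance instRightModuleResE (M : Type*) [AddCommMonoid M] [Module k M]
    [RightModule k (MonoidAlgebra k S) M] :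
    RightModule k (MonoidAlgebra k (MaxSubgroup he)) (resE k e M) where
  actHom := LinearMap.mk₂ k
    (fun m b => ⟨act k m.1 (inclS k he b), ⟨act k m.1 (inclS k he b), by
      change act k (act k m.1 (inclS k he b)) (el k e) = _
      rw [← act_mul, inclS_mul_el]⟩⟩)
    (fun _ _ _ => Subtype.ext (add_act k _ _ _))
    (fun _ _ _ => Subtype.ext (smul_act k _ _ _))
    (fun _ _ _ => Subtype.ext (by simp only [map_add, act_add, Submodule.coe_add]))
    (fun _ _ _ => Subtype.ext (by simp only [map_smul, act_smul, Submodule.coe_smul]))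
  actHom_mul _ _ _ := Subtype.ext (by
    simp only [map_mul, LinearMap.mk₂_apply]
    exact act_mul k _ _ _)

variable (V : Type*) [AddCommMonoid V] [Module k V]
  [RightModule k (MonoidAlgebra k (MaxSubgroup he)) V]

/-- The relation `v b ⊗ z ∼ v ⊗ b z` on `V ⊗_k e A_J`. -/
inductive BalancedRel : V ⊗[k] eA k J e → V ⊗[k] eA k J e → Prop
  | mk (v : V) (b : MonoidAlgebra k (MaxSubgroup he)) (z : eA k J e) :
      BalancedRel (act k v b ⊗ₜ[k] z) (v ⊗ₜ[k] groupMul k J he b z)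

/-- The congruence on `V ⊗_k e A_J` generated by `v b ⊗ z ∼ v ⊗ b z`. -/
def indCon : ModuleCon k (V ⊗[k] eA k J e) :=
  SMulCon.addConGen' (BalancedRel k J he V) (by
    rintro c _ _ ⟨v, b, z⟩
    have h := BalancedRel.mk (V := V) (k := k) (J := J) (he := he) (c • v) b z
    rwa [smul_act, ← TensorProduct.smul_tmul', ← TensorProduct.smul_tmul'] at h)

/-- `Ind_J(V) = V ⊗_{k G_e} e A_J`. -/
def IndJ : Type _ := (indCon k J he V).Quotient

instance : AddCommMonoid (IndJ k J he V) := inferInstanceAs (AddCommMonoid (indCon k J he V).Quotient)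

instance : Module k (IndJ k J he V) := inferInstanceAs (Module k (indCon k J he V).Quotient)

/-- The action of `a` on `V ⊗_k e A_J`. -/
def tensorAct (a : AJ k J) : V ⊗[k] eA k J e →ₗ[k] V ⊗[k] eA k J e :=
  TensorProduct.map LinearMap.id
    ((RightModule.actHom (k := k) (A := AJ k J) (M := eA k J e)).flip a)

theorem tensorAct_rel (a : AJ k J) {p q : V ⊗[k] eA k J e} (h : (indCon k J he V).r p q) :
    (indCon k J he V).r (tensorAct k J V a p) (tensorAct k J V a q) := by
  have key : addConGen (BalancedRel k J he V) ≤
      (addConGen (BalancedRel k J he V)).comap (tensorAct k J V a).toAddMonoidHom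
        (map_add _) := by
    refine AddCon.addConGen_le.2 ?_
    rintro _ _ ⟨v, b, z⟩
    refine AddConGen.Rel.of _ _ ?_
    have h := BalancedRel.mk (V := V) (k := k) (J := J) (he := he) v b (act k z a)
    have h2 : groupMul k J he b (act k z a) = act k (groupMul k J he b z) a :=
      Subtype.ext (mul_assoc _ _ _).symm
    rw [h2] at h
    exact h
  exact key h

/-- The right action of `A_J` on `Ind_J(V)`, given by `(v ⊗ z) a = v ⊗ z a`. -/
instance IndJ.instRightModule : RightModule k (AJ k J) (IndJ k J he V) where
  actHom := LinearMap.mk₂ k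
    (fun m a => (Quotient.map (tensorAct k J V a)
      (fun _ _ h => tensorAct_rel k J he V a h) m : (indCon k J he V).Quotient))
    (by
      rintro ⟨m⟩ ⟨n⟩ a
      exact congrArg (Quotient.mk (indCon k J he V).toSetoid) (map_add (tensorAct k J V a) m n))
    (by
      rintro c ⟨m⟩ a
      exact congrArg (Quotient.mk (indCon k J he V).toSetoid) (map_smul (tensorAct k J V a) c m))
    (by
      rintro ⟨m⟩ a b
      refine congrArg (Quotient.mk (indCon k J he V).toSetoid) ?_
      change tensorAct k J V (a + b) m = tensorAct k J V a m + tensorAct k J V b m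
      simp only [tensorAct, map_add, TensorProduct.map_add_right, LinearMap.add_apply])
    (by
      rintro c ⟨m⟩ a
      refine congrArg (Quotient.mk (indCon k J he V).toSetoid) ?_
      change tensorAct k J V (c • a) m = c • tensorAct k J V a m
      simp only [tensorAct, map_smul, TensorProduct.map_smul_right, LinearMap.smul_apply])
  actHom_mul := by
    rintro ⟨m⟩ a b
    refine congrArg (Quotient.mk (indCon k J he V).toSetoid) ?_
    change tensorAct k J V (a * b) m = tensorAct k J V b (tensorAct k J V a m)
    induction m using TensorProduct.induction_on with
    | zero => simp
    | add p q hp hq => simp only [map_add, hp, hq]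
    | tmul v z =>
      refine congrArg (fun y => v ⊗ₜ[k] y) ?_
      exact RightModule.actHom_mul (k := k) (A := AJ k J) z a b

/-- `Ind_J(V)` as a right `kS`-module. -/
instance IndJ.instRightModuleS : RightModule k (MonoidAlgebra k S) (IndJ k J he V) :=
  restrictToS k J _

/-- `Coind_J(V) = Hom_{k G_e}(A_J e, V)`. -/
def CoindJ : Type _ := rHom k (MonoidAlgebra k (MaxSubgroup he)) (Ae k J e) V

instance : AddCommMonoid (CoindJ k J he V) :=
  inferInstanceAs (AddCommMonoid (rHom k (MonoidAlgebra k (MaxSubgroup he)) (Ae k J e) V))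

instance : Module k (CoindJ k J he V) :=
  inferInstanceAs (Module k (rHom k (MonoidAlgebra k (MaxSubgroup he)) (Ae k J e) V))

/-- The right action of `A_J` on `Coind_J(V)`, given by `(f a)(z) = f (a z)`. -/
instance CoindJ.instRightModule : RightModule k (AJ k J) (CoindJ k J he V) where
  actHom := LinearMap.mk₂ k
    (fun f a => (⟨f.1.comp (leftMulAe k J a), fun z b => by
      have h : leftMulAe k J a (act k z b) = act k (leftMulAe k J a z) b :=
        Subtype.ext (mul_assoc _ _ _).symm
      simp only [LinearMap.comp_apply]
      rw [h, f.2]⟩ : rHom k (MonoidAlgebra k (MaxSubgroup he)) (Ae k J e) V))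
    (fun _ _ _ => rfl)
    (fun _ _ _ => rfl)
    (fun f a b => Subtype.ext (LinearMap.ext fun z => by
      have h : leftMulAe k J (a + b) z = leftMulAe k J a z + leftMulAe k J b z :=
        Subtype.ext (add_mul _ _ _)
      change f.1 (leftMulAe k J (a + b) z) = f.1 (leftMulAe k J a z) + f.1 (leftMulAe k J b z)
      rw [h, map_add]))
    (fun c f a => Subtype.ext (LinearMap.ext fun z => by
      have h : leftMulAe k J (c • a) z = c • leftMulAe k J a z :=
        Subtype.ext (smul_mul_assoc _ _ _)
      change f.1 (leftMulAe k J (c • a) z) = c • f.1 (leftMulAe k J a z)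
      rw [h, map_smul]))
  actHom_mul f a b := Subtype.ext (LinearMap.ext fun z => by
    have h : leftMulAe k J (a * b) z = leftMulAe k J a (leftMulAe k J b z) :=
      Subtype.ext (mul_assoc _ _ _)
    change f.1 (leftMulAe k J (a * b) z) = f.1 (leftMulAe k J a (leftMulAe k J b z))
    rw [h])

/-- `Coind_J(V)` as a right `kS`-module. -/
instance CoindJ.instRightModuleS : RightModule k (MonoidAlgebra k S) (CoindJ k J he V) :=
  restrictToS k J _

/-- The congruence `N` on `Ind_J(V)`: `u ∼ v` iff `u a e = v a e` for all `a` in `A_J`. -/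
def indN : RCon k (MonoidAlgebra k S) (IndJ k J he V) where
  r p q := ∀ a : AJ k J, act k (act k p a) (elA k J e) = act k (act k q a) (elA k J e)
  iseqv := ⟨fun _ _ => rfl, fun h a => (h a).symm, fun h h' a => (h a).trans (h' a)⟩
  add' h h' a := by simp only [add_act, h a, h' a]
  smul c _ _ h a := by simp only [smul_act, h a]
  act_rel p q s h a := by
    have key : ∀ m : IndJ k J he V, act k (act k m s) a = act k m (toAJ k J s * a) :=
      fun m => (act_mul k m (toAJ k J s) a).symm
    rw [key, key]
    exact h _

/-- The submodule `K` of `Ind_J(V)`: all `m` with `m a e = 0` for all `a` in `A_J`. -/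
def indK : RSub k (MonoidAlgebra k S) (IndJ k J he V) where
  carrier := {m | ∀ a : AJ k J, act k (act k m a) (elA k J e) = 0}
  add_mem' h h' a := by simp only [add_act, h a, h' a, add_zero]
  zero_mem' a := by simp [act]
  smul_mem' c m h a := by simp only [smul_act, h a, smul_zero]
  act_mem m s h a := by
    have key : act k (act k m s) a = act k m (toAJ k J s * a) :=
      (act_mul k m (toAJ k J s) a).symm
    rw [key]
    exact h _

/-- The submodule `Coind_J(V) e kS` of `Coind_J(V)`, spanned by all `f e a` with `a` in `kS`. -/
def coindL : RSub k (MonoidAlgebra k S) (CoindJ k J he V) where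
  toSubmodule := Submodule.span k
    {m | ∃ (f : CoindJ k J he V) (a : MonoidAlgebra k S), m = act k (act k f (el k e)) a}
  act_mem m s hm := by
    induction hm using Submodule.span_induction with
    | mem m hm =>
      obtain ⟨f, a, rfl⟩ := hm
      exact Submodule.subset_span ⟨f, a * s, (act_mul k _ _ _).symm⟩
    | zero => simp [act]
    | add p q _ _ hp hq => rw [add_act]; exact Submodule.add_mem _ hp hq
    | smul c p _ hp => rw [smul_act]; exact Submodule.smul_mem _ _ hp

/-- The quotient `kS`-module `Ind_J(V) / N`. -/
abbrev IndModN : Type _ := (indN k J he V).toModuleCon.Quotient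

/-- The `kS`-module `Coind_J(V) e kS`. -/
abbrev CoindL : Type _ := (coindL k J he V).toSubmodule

end Functors

/-- `J` is the apex of `M`: the annihilator in `S` of `M` is `notAbove J`. -/
def HasApex (k : Type*) [CommSemiring k] {S : Type*} [Semigroup S] (M : Type*) [AddCommMonoid M]
    [Module k M] [RightModule k (MonoidAlgebra k S) M] (J : RegJClass S) : Prop :=
  {s : S | ∀ m : M, act k m (el k s) = 0} = notAbove J.1

end SemiringRep

end

open SemiringRep

namespace SemiringRep

/-! ### Idempotents and regular `𝒥`-classes in finite semigroups -/

section FiniteSemigroup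

/-! This is Clifford–Munn–Ponizovskii theory carried out without subtraction. The pivot: since `S`
is finite, `ese` is either a unit of `eSe` or lies in `I_J` (`isUnit_corner_iff`), so `e A_J e` is a
copy of `kG_J` (`toAJ_el_mul_mul_el`). Hence, on a module `M` killed by `I_J`, passing from `m ∈ Me`
to `(ma)e` is the action of the element `eae` of `kG_J`, and minimality and simplicity descend from
`M` to `Me`.

Conversely, let `M` be generated by `Me`. If `Me` is minimal, a submodule with an element `m` such
that `mae ≠ 0` meets `Me` nontrivially, so contains `Me` and equals `M`: every proper submodule lies
in the analogue `resK` of `K` (`RSub.le_resK`). If `Me` is simple, a congruence relating `u`, `v`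
with `uae ≠ vae` is nontrivial on `Me`, so collapses `Me`; its class of zero is a submodule, hence
everything: every proper congruence lies in the analogue `resN` of `N` (`RCon.le_resN`).

`Ind_J(V)` is generated by its `e`-part `V ⊗ e ≅ V`. An isomorphism `V ≅ Me` extends to a
homomorphism `Ind_J(V) → M`, onto when `M` is minimal, with kernel inside `N`
(`IndJ.exists_surjective`); for irreducible `M` the kernel is `N`. Dually, an element `f` of
`Coind_J(V)` is determined by the elements `fae`, so a nonzero submodule contains a nonzero part of
the copy of `V` there, and therefore all of `Coind_J(V)e_JkS`.

For the bijection it remains to find an apex for each irreducible `M`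
(`IsMinimalModule.exists_hasApex`). Take `s` with `Ms ≠ 0` and `J(s)` as small as possible.
Minimality of `M` yields `t ∈ J(s)` with `M(st) ≠ 0`; then `t` and `st` are `𝒥`-equivalent to `s`,
which by finiteness forces an idempotent. Finally `J` is recovered as the apex and `V` as `Me`. -/

theorem exists_pow_isIdempotentElem {M : Type*} [Monoid M] [Finite M] (a : M) :
    ∃ n, 0 < n ∧ IsIdempotentElem (a ^ n) := by
  obtain ⟨i, j, hij, h⟩ := Finite.exists_ne_map_eq_of_infinite (fun n : ℕ => a ^ n)
  wlog hlt : i < j generalizing i j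
  · exact this j i hij.symm h.symm (by omega)
  obtain ⟨d, rfl⟩ := Nat.exists_eq_add_of_lt hlt
  have key : ∀ c l : ℕ, i ≤ l → a ^ (l + c * (d + 1)) = a ^ l := by
    intro c
    induction c with
    | zero => simp
    | succ c ih =>
      intro l hl
      obtain ⟨r, rfl⟩ := Nat.exists_eq_add_of_le hl
      have h' : a ^ (i + d + 1) = a ^ i := h.symm
      rw [show i + r + (c + 1) * (d + 1) = (i + d + 1) + (r + c * (d + 1)) by ring, pow_add, h',
        ← pow_add, ← add_assoc, ih _ hl]
  -- The powers of `a` have period `d + 1` from exponent `i` on. The exponent chosen is positive, at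
  -- least `i`, and a multiple of the period, so doubling it changes nothing.
  refine ⟨(i + 1) * (d + 1), by positivity, ?_⟩
  rw [IsIdempotentElem, ← pow_add]
  exact key _ _ (by nlinarith)

variable {S : Type*} [Semigroup S]

theorem exists_coe_eq_coe_mul (y : S) (q : WithOne S) : ∃ z : S, (z : WithOne S) = y * q := by
  induction q using WithOne.recOneCoe with
  | one => exact ⟨y, by simp⟩
  | coe q => exact ⟨y * q, by simp⟩

theorem exists_coe_eq_mul_coe (y : S) (q : WithOne S) : ∃ z : S, (z : WithOne S) = q * y := by
  induction q using WithOne.recOneCoe with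
  | one => exact ⟨y, by simp⟩
  | coe q => exact ⟨q * y, by simp⟩

theorem principalIdeal_subset {s t : S} (h : t ∈ principalIdeal s) :
    principalIdeal t ⊆ principalIdeal s := by
  obtain ⟨p, q, h⟩ := h
  rintro r ⟨p', q', h'⟩
  exact ⟨p' * p, q * q', by rw [h', h]; simp [mul_assoc]⟩

/-- If `s t` and `t` are `𝒥`-equivalent to `s`, the `𝒥`-class of `s` contains an idempotent. -/
theorem exists_idempotent_jRel [Finite S] {s t : S} (ht : JRel s t) (hst : JRel s (s * t)) :
    ∃ f, JRel s f ∧ IsIdempotentElem f := by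
  have : Finite (WithOne S) := inferInstanceAs (Finite (Option S))
  obtain ⟨p, q, hpq⟩ : s ∈ principalIdeal (s * t) := hst ▸ self_mem_principalIdeal s
  -- Iterating `s = p s y` gives `s = p ^ n s y ^ n`; the idempotent will be a power of `y`.
  set y : WithOne S := t * q with hy
  have hs : ∀ n : ℕ, (s : WithOne S) = p ^ n * s * y ^ n := by
    intro n
    induction n with
    | zero => simp
    | succ n ih =>
      calc (s : WithOne S) = p ^ n * (p * ((s * t : S) : WithOne S) * q) * y ^ n := by
            rw [← hpq]; exact ih
        _ = p ^ (n + 1) * s * y ^ (n + 1) := by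
            rw [pow_succ, pow_succ' y, WithOne.coe_mul, hy]; simp only [mul_assoc]
  obtain ⟨n, hn, hid⟩ := exists_pow_isIdempotentElem y
  -- A positive exponent makes `y ^ n = t (q y ^ m)` an element of `S`, not merely of `S¹`, and puts
  -- it in `J(t)`.
  obtain ⟨m, rfl⟩ : ∃ m, n = m + 1 := ⟨n - 1, by omega⟩
  obtain ⟨f, hf⟩ := exists_coe_eq_coe_mul t (q * y ^ m)
  have hfy : (f : WithOne S) = y ^ (m + 1) := by rw [hf, pow_succ', hy, mul_assoc]
  refine ⟨f, Set.Subset.antisymm ?_ ?_, ?_⟩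
  -- Here `s = s f`, because `s = p ^ n s f` and `f` is idempotent.
  · refine principalIdeal_subset ⟨s, 1, ?_⟩
    conv_lhs => rw [hs (m + 1)]
    conv_rhs => rw [hs (m + 1)]
    rw [hfy, mul_one, mul_assoc, mul_assoc, mul_assoc, hid.eq]
  · rw [show principalIdeal s = principalIdeal t from ht]
    exact principalIdeal_subset ⟨1, q * y ^ m, by rw [hf, one_mul]⟩
  · exact WithOne.coe_injective (by rw [WithOne.coe_mul, hfy]; exact hid)

variable {J : RegJClass S} {e : S}

theorem RegJClass.eq_setOf_jRel (he : e ∈ J.1) : J.1 = {t | JRel e t} := by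
  obtain ⟨⟨s, hs⟩, -⟩ := J.2
  rw [hs] at he ⊢
  ext t
  exact ⟨fun h => (Eq.symm he).trans h, fun h => Eq.trans he h⟩

theorem RegJClass.mem_notAbove_iff (he : e ∈ J.1) {s : S} :
    s ∈ notAbove J.1 ↔ e ∉ principalIdeal s := by
  refine not_congr ⟨fun h => h he, fun h => ?_⟩
  rw [RegJClass.eq_setOf_jRel he]
  intro t ht
  exact principalIdeal_subset h (by rw [show principalIdeal e = _ from ht]; exact self_mem_principalIdeal t)

/-- A representative of `J` lies above `J`, hence above `J'`, and conversely, so the two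
representatives generate the same ideal. This makes the apex unique. -/
theorem RegJClass.notAbove_injective {J J' : RegJClass S} (h : notAbove J.1 = notAbove J'.1) :
    J = J' := by
  obtain ⟨⟨s, hs⟩, -⟩ := J.2
  obtain ⟨⟨s', hs'⟩, -⟩ := J'.2
  have hm : s ∈ J.1 := by rw [hs]; rfl
  have hm' : s' ∈ J'.1 := by rw [hs']; rfl
  have h1 : s' ∈ principalIdeal s := by
    have : s ∉ notAbove J'.1 := by
      rw [← h, RegJClass.mem_notAbove_iff hm, not_not]; exact self_mem_principalIdeal s
    rwa [RegJClass.mem_notAbove_iff hm', not_not] at this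
  have h2 : s ∈ principalIdeal s' := by
    have : s' ∉ notAbove J.1 := by
      rw [h, RegJClass.mem_notAbove_iff hm', not_not]; exact self_mem_principalIdeal s'
    rwa [RegJClass.mem_notAbove_iff hm, not_not] at this
  have h3 : principalIdeal s = principalIdeal s' :=
    (principalIdeal_subset h2).antisymm (principalIdeal_subset h1)
  apply Subtype.ext
  rw [hs, hs']
  ext t
  simp only [Set.mem_ofPred_eq, JRel, h3]

/-- The element `e s e` of the monoid `eSe`. -/
def corner (he : IsIdempotentElem e) (s : S) : LocalMonoid he := ⟨e * s * e, s, rfl⟩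

/-- If `e = p(ese)q`, sandwiching `p` and `q` between copies of `e` gives `a x b = 1` in the finite
monoid `eSe`, where `x = ese`. One-sided inverses in a finite monoid are two-sided, so `ba` inverts
`x`. -/
theorem isUnit_corner_iff [Finite S] (he : IsIdempotentElem e) (heJ : e ∈ J.1) (s : S) :
    IsUnit (corner he s) ↔ e * s * e ∉ notAbove J.1 := by
  have : Finite (LocalMonoid he) := inferInstanceAs (Finite (Subsemigroup.corner e))
  rw [RegJClass.mem_notAbove_iff heJ, not_not]
  constructor
  · rintro ⟨g, hg⟩
    refine ⟨g⁻¹.1.1, 1, ?_⟩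
    have h := congrArg Subtype.val (g.inv_mul)
    rw [hg] at h
    rw [mul_one, ← WithOne.coe_mul]
    exact congrArg _ h.symm
  · rintro ⟨p, q, h⟩
    obtain ⟨a, ha⟩ := exists_coe_eq_coe_mul e p
    obtain ⟨b, hb⟩ := exists_coe_eq_mul_coe e q
    have h1 : corner he a * corner he s * corner he b = 1 := by
      apply Subtype.ext
      change (e * a * e) * (e * s * e) * (e * b * e) = e
      apply WithOne.coe_injective
      have h2 : (e : WithOne S) * e = e := by rw [← WithOne.coe_mul, he.eq]
      have h3 : ∀ z : WithOne S, (e : WithOne S) * (e * z) = e * z := fun z => by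
        rw [← mul_assoc, h2]
      have h4 : (e : WithOne S) * e * e = e := by rw [h2, h2]
      conv_rhs => rw [← h4]
      conv_rhs => arg 1; arg 2; rw [h]
      simp only [WithOne.coe_mul, ha, hb, mul_assoc, h3, h2]
    have h5 := mul_eq_one_symm h1
    rw [← mul_assoc] at h5
    have h6 := mul_eq_one_symm h5
    rw [mul_assoc] at h1
    have h7 := mul_eq_one_symm h1
    rw [mul_assoc] at h7
    exact isUnit_iff_exists.mpr ⟨corner he b * corner he a, h7, by rw [← h5]⟩

theorem corner_groupIncl (he : IsIdempotentElem e) (g : MaxSubgroup he) :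
    corner he (groupIncl he g) = g.1 := by
  apply Subtype.ext
  change e * groupIncl he g * e = _
  rw [mul_groupIncl, groupIncl_mul]
  rfl

end FiniteSemigroup

/-! ### Submodules, congruences and minimality without subtraction -/

section Modules

variable {k : Type*} [CommSemiring k] {A : Type*} [NonUnitalSemiring A] [Module k A]
variable {M : Type*} [AddCommMonoid M] [Module k M] [RightModule k A M]
variable {N : Type*} [AddCommMonoid N] [Module k N] [RightModule k A N]

theorem zero_act (a : A) : act k (0 : M) a = 0 := by simp [act]

theorem act_zero (m : M) : act k m (0 : A) = 0 := by simp [act]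

theorem RSub.ext {W W' : RSub k A M} (h : W.toSubmodule = W'.toSubmodule) : W = W' := by
  cases W; cases W'; cases h; rfl

theorem RCon.ext {R R' : RCon k A M} (h : ∀ m n, R.r m n ↔ R'.r m n) : R = R' := by
  obtain ⟨⟨⟨⟨r, _⟩, _⟩, _⟩, _⟩ := R
  obtain ⟨⟨⟨⟨r', _⟩, _⟩, _⟩, _⟩ := R'
  obtain rfl : r = r' := by ext m n; exact h m n
  rfl

theorem RCon.rel_refl (R : RCon k A M) (m : M) : R.r m m := R.iseqv.refl m

theorem RCon.rel_symm (R : RCon k A M) {m n : M} (h : R.r m n) : R.r n m := R.iseqv.symm h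

theorem RCon.rel_trans (R : RCon k A M) {m n p : M} (h : R.r m n) (h' : R.r n p) : R.r m p :=
  R.iseqv.trans h h'

/-- Submodules and congruences carry only an `LE`, so antisymmetry enters as an argument. -/
theorem maximal_iff_of_forall_le {α : Type*} [LE α] (P : α → Prop) (c : α) (hc : P c)
    (hle : ∀ a, P a → a ≤ c) (hanti : ∀ a b : α, a ≤ b → b ≤ a → a = b) (a : α) :
    Maximal P a ↔ a = c := by
  constructor
  · intro h
    exact hanti _ _ (hle a h.1) (h.2 hc (hle a h.1))
  · rintro rfl
    exact ⟨hc, fun b hb _ => hle b hb⟩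

theorem RSub.le_antisymm {W W' : RSub k A M} (h : W ≤ W') (h' : W' ≤ W) : W = W' :=
  RSub.ext (_root_.le_antisymm (show W.toSubmodule ≤ W'.toSubmodule from h) h')

theorem RCon.le_antisymm {R R' : RCon k A M} (h : R ≤ R') (h' : R' ≤ R) : R = R' :=
  RCon.ext fun m n => ⟨h m n, h' m n⟩

/-- The preimage of a submodule under a homomorphism. -/
def RSub.comap (f : M →ₗ[k] N) (hf : ∀ m (a : A), f (act k m a) = act k (f m) a)
    (W : RSub k A N) : RSub k A M where
  toSubmodule := W.toSubmodule.comap f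
  act_mem m a hm := by
    rw [Submodule.mem_comap, hf]
    exact W.act_mem _ _ hm

/-- The image of a submodule under a homomorphism. -/
def RSub.map (f : M →ₗ[k] N) (hf : ∀ m (a : A), f (act k m a) = act k (f m) a)
    (W : RSub k A M) : RSub k A N where
  toSubmodule := W.toSubmodule.map f
  act_mem m a hm := by
    obtain ⟨m, hm, rfl⟩ := hm
    exact ⟨act k m a, W.act_mem _ _ hm, hf m a⟩

variable (k A M) in
/-- The whole module as a submodule. -/
def RSub.univ : RSub k A M := ⟨⊤, fun _ _ _ => trivial⟩

/-- The preimage of a congruence under a homomorphism. -/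
def RCon.comap (f : M →ₗ[k] N) (hf : ∀ m (a : A), f (act k m a) = act k (f m) a)
    (R : RCon k A N) : RCon k A M where
  r m n := R.r (f m) (f n)
  iseqv := ⟨fun _ => R.rel_refl _, fun h => R.rel_symm h, fun h h' => R.rel_trans h h'⟩
  add' h h' := by rw [map_add, map_add]; exact R.add' h h'
  smul c _ _ h := by rw [map_smul, map_smul]; exact R.smul c h
  act_rel m n a h := by rw [hf, hf]; exact R.act_rel _ _ a h

variable (k A M) in
/-- The equality congruence. -/
def RCon.eq : RCon k A M where
  r m n := m = n
  iseqv := ⟨fun _ => rfl, Eq.symm, Eq.trans⟩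
  add' h h' := by rw [h, h']
  smul c _ _ h := by rw [h]
  act_rel m n a h := by rw [h]

/-- The projection to the quotient by a congruence. -/
def RCon.proj (R : RCon k A M) : M →ₗ[k] R.toModuleCon.Quotient where
  toFun := Quotient.mk R.toSetoid
  map_add' _ _ := rfl
  map_smul' _ _ := rfl

theorem RCon.proj_surjective (R : RCon k A M) : Function.Surjective R.proj := Quotient.mk_surjective

theorem RCon.proj_act (R : RCon k A M) (m : M) (a : A) : R.proj (act k m a) = act k (R.proj m) a := rfl

theorem RCon.proj_eq_proj_iff (R : RCon k A M) {m n : M} : R.proj m = R.proj n ↔ R.r m n :=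
  ⟨fun h => Quotient.exact (s := R.toSetoid) h, fun h => Quotient.sound (s := R.toSetoid) h⟩

/-- The first isomorphism theorem. -/
theorem isomorphic_quotient_ker (f : M →ₗ[k] N) (hf : ∀ m (a : A), f (act k m a) = act k (f m) a)
    (hs : Function.Surjective f) :
    Isomorphic k A N ((RCon.eq k A N).comap f hf).toModuleCon.Quotient := by
  set R := (RCon.eq k A N).comap f hf with hR
  let g : R.toModuleCon.Quotient →ₗ[k] N :=
    { toFun := Quotient.lift f fun _ _ h => h
      map_add' := by rintro ⟨a⟩ ⟨b⟩; exact map_add f a b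
      map_smul' := by rintro c ⟨a⟩; exact map_smul f c a }
  have hg : Function.Bijective g := by
    refine ⟨?_, fun n => ?_⟩
    · rintro ⟨a⟩ ⟨b⟩ h
      exact Quotient.sound (s := R.toSetoid) h
    · obtain ⟨m, rfl⟩ := hs n
      exact ⟨R.proj m, rfl⟩
  refine Isomorphic.symm ⟨LinearEquiv.ofBijective g hg, ?_⟩
  rintro ⟨m⟩ a
  exact hf m a

/-- For a minimal module, submodules are zero or everything. -/
theorem IsMinimalModule.eq_top (h : IsMinimalModule k A M) (W : RSub k A M) {m : M}
    (hm : m ∈ W.toSubmodule) (h0 : m ≠ 0) (n : M) : n ∈ W.toSubmodule := by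
  by_contra hn
  refine h.2 W (fun ht => hn (ht ▸ trivial)) (fun hb => h0 ?_)
  rw [hb] at hm
  exact hm

theorem IsSimpleRightModule.rel (h : IsSimpleRightModule k A M) (R : RCon k A M) {m n : M}
    (hmn : R.r m n) (hne : m ≠ n) (p q : M) : R.r p q := by
  by_contra hn
  exact hne (h.2 R ⟨p, q, hn⟩ m n hmn)

/-- In a minimal module every non-zero element generates. -/
theorem IsMinimalModule.exists_act_eq (h : IsMinimalModule k A M) {m : M} (hm : m ≠ 0) (n : M) :
    ∃ a : A, act k m a = n := by
  let W : RSub k A M :=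
    { toSubmodule := LinearMap.range (RightModule.actHom (k := k) (A := A) m)
      act_mem := by
        rintro _ b ⟨a, rfl⟩
        exact ⟨a * b, act_mul k m a b⟩ }
  -- The elements annihilated by `A` form a submodule. If `m` were one of them, minimality would
  -- give `MA = 0`; so `mA` is nonzero, and minimality makes it everything.
  let Z : RSub k A M :=
    { carrier := {m | ∀ a : A, act k m a = 0}
      add_mem' := fun h h' a => by rw [add_act, h a, h' a, add_zero]
      zero_mem' := zero_act
      smul_mem' := fun c m h a => by rw [smul_act, h a, smul_zero]
      act_mem := fun m a h b => by rw [← act_mul]; exact h _ }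
  obtain ⟨m₀, a₀, h0⟩ := h.1
  have : ∃ a : A, act k m a ≠ 0 := by
    by_contra! hz
    exact h0 (h.eq_top Z (m := m) hz hm m₀ a₀)
  obtain ⟨a, ha⟩ := this
  exact h.eq_top W ⟨a, rfl⟩ ha n

theorem isMinimalModule_of_exists_act_eq (h : ActsNonzero k A M)
    (hM : ∀ m : M, m ≠ 0 → ∀ n, ∃ a : A, act k m a = n) : IsMinimalModule k A M := by
  refine ⟨h, fun W hW hW0 => ?_⟩
  obtain ⟨m, hm, hm0⟩ := (Submodule.ne_bot_iff _).1 hW0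
  refine hW (eq_top_iff.2 fun n _ => ?_)
  obtain ⟨a, rfl⟩ := hM m hm0 n
  exact W.act_mem _ _ hm

theorem IsMinimalModule.congr (h : IsMinimalModule k A M) (i : Isomorphic k A M N) :
    IsMinimalModule k A N := by
  obtain ⟨f, hf⟩ := i
  obtain ⟨m, a, hm⟩ := h.1
  refine isMinimalModule_of_exists_act_eq ⟨f m, a, ?_⟩ fun n hn n' => ?_
  · rwa [← hf, ne_eq, LinearEquiv.map_eq_zero_iff]
  · obtain ⟨a, ha⟩ := h.exists_act_eq (m := f.symm n) (by rwa [ne_eq, LinearEquiv.map_eq_zero_iff])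
      (f.symm n')
    refine ⟨a, f.symm.injective ?_⟩
    rw [← ha, LinearEquiv.symm_apply_eq, hf, LinearEquiv.apply_symm_apply]

theorem IsSimpleRightModule.congr (h : IsSimpleRightModule k A M) (i : Isomorphic k A M N) :
    IsSimpleRightModule k A N := by
  obtain ⟨f, hf⟩ := i
  obtain ⟨m, a, hm⟩ := h.1
  refine ⟨⟨f m, a, ?_⟩, fun R ⟨p, q, hpq⟩ n n' hn => ?_⟩
  · rwa [← hf, ne_eq, LinearEquiv.map_eq_zero_iff]
  · by_contra hne
    have := h.rel (R.comap f.toLinearMap hf) (m := f.symm n) (n := f.symm n')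
      (by simpa [RCon.comap] using hn) (by simpa using hne) (f.symm p) (f.symm q)
    exact hpq (by simpa [RCon.comap] using this)

theorem IsIrreducibleModule.congr (h : IsIrreducibleModule k A M) (i : Isomorphic k A M N) :
    IsIrreducibleModule k A N := ⟨h.1.congr i, h.2.congr i⟩

end Modules

noncomputable section

/-! ### The identification of `e A_J e` with `kG_J` -/

section Retraction

theorem single_eq_smul_el {k : Type*} [CommSemiring k] {S : Type*} (s : S) (c : k) :
    (MonoidAlgebra.single s c : MonoidAlgebra k S) = c • el k s := by
  simp [el]

variable (k : Type*) [CommSemiring k] {S : Type*} [Semigroup S]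

/-- A linear map on `kS` that kills `notAbove J` descends to `A_J`. -/
def AJ.lift {k} [CommSemiring k] {J : Set S} {P : Type*} [AddCommMonoid P] [Module k P]
    (g : MonoidAlgebra k S →ₗ[k] P) (hg : ∀ s ∈ notAbove J, g (el k s) = 0) : AJ k J →ₗ[k] P :=
  have hz : ∀ n ∈ spanIn k (notAbove J), g n = 0 := fun n hn => by
    have : spanIn k (notAbove J) ≤ LinearMap.ker g := by
      rw [spanIn, Submodule.span_le]
      rintro _ ⟨s, hs, rfl⟩
      exact hg s hs
    exact this hn
  { toFun := Quotient.lift g (by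
      rintro a b ⟨n, hn, n', hn', h⟩
      have := congrArg g h
      rwa [map_add, map_add, hz n hn, hz n' hn', add_zero, add_zero] at this)
    map_add' := by rintro ⟨a⟩ ⟨b⟩; exact map_add g a b
    map_smul' := by rintro c ⟨a⟩; exact map_smul g c a }

theorem toAJ_surjective (J : Set S) : Function.Surjective (toAJ k J) := toAJFun_surjective k J

theorem toAJ_el_eq_zero {J : Set S} {s : S} (hs : s ∈ notAbove J) : toAJ k J (el k s) = 0 :=
  Quotient.sound (s := (modCon (spanIn k (notAbove J))).toSetoid)
    ⟨0, Submodule.zero_mem _, el k s, Submodule.subset_span ⟨s, hs, rfl⟩, add_comm _ _⟩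

variable {e : S} (he : IsIdempotentElem e)

theorem el_mul_el (s t : S) : el k s * el k t = el k (s * t) := by
  simp [el, MonoidAlgebra.single_mul_single]

open Classical in
/-- The linear map `kS → kG_e` that sends `s` to `ese` if this is a unit of `eSe`, else to `0`. -/
def rho : MonoidAlgebra k S →ₗ[k] MonoidAlgebra k (MaxSubgroup he) :=
  (MonoidAlgebra.basis S k).constr k fun s =>
    if h : IsUnit (corner he s) then MonoidAlgebra.single h.unit 1 else 0

open Classical in
theorem rho_el (s : S) : rho k he (el k s) =
    if h : IsUnit (corner he s) then MonoidAlgebra.single h.unit 1 else 0 := by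
  rw [el, ← MonoidAlgebra.basis_apply, rho, Module.Basis.constr_basis]

theorem rho_inclS (b : MonoidAlgebra k (MaxSubgroup he)) : rho k he (inclS k he b) = b := by
  induction b using MonoidAlgebra.induction_linear with
  | zero => simp
  | add f g hf hg => rw [map_add, map_add, hf, hg]
  | single g c =>
    have hu : IsUnit (corner he (groupIncl he g)) := by rw [corner_groupIncl]; exact g.isUnit
    have hg : hu.unit = g := Units.ext (by rw [IsUnit.unit_spec, corner_groupIncl])
    rw [inclS_single, single_eq_smul_el, map_smul, rho_el, dif_pos hu, hg]
    simp

theorem inclS_one : inclS k he 1 = el k e := by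
  rw [MonoidAlgebra.one_def, inclS_single]; rfl

theorem elA_mul_elA {e : S} (he : IsIdempotentElem e) (J : Set S) : elA k J e * elA k J e = elA k J e := by
  rw [elA, ← map_mul, el_mul_el, he.eq]

variable [Finite S] {J : RegJClass S}

/-- Each `ese` is a group element or lies in `I_J`, where it vanishes in `A_J`. With the left
inverse `rhoA` of `inclA`, this identifies `e A_J e` with `kG_J`. -/
theorem toAJ_el_mul_mul_el (heJ : e ∈ J.1) (a : MonoidAlgebra k S) :
    toAJ k J.1 (el k e * a * el k e) = inclA k J.1 he (rho k he a) := by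
  induction a using MonoidAlgebra.induction_linear with
  | zero => simp
  | add f g hf hg => simp only [mul_add, add_mul, map_add, hf, hg]
  | single s c =>
    rw [single_eq_smul_el, mul_smul_comm, smul_mul_assoc, map_smul, map_smul, map_smul, rho_el,
      el_mul_el, el_mul_el]
    congr 1
    split_ifs with h
    · change _ = toAJ k J.1 (inclS k he _)
      rw [inclS_single]
      rfl
    · rw [isUnit_corner_iff he heJ, not_not] at h
      rw [toAJ_el_eq_zero k h, map_zero]

theorem rho_el_eq_zero (heJ : e ∈ J.1) {s : S} (hs : s ∈ notAbove J.1) : rho k he (el k s) = 0 := by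
  rw [rho_el, dif_neg]
  rw [isUnit_corner_iff he heJ, not_not]
  exact mul_mem_notAbove_right e (mul_mem_notAbove_left e hs)

/-- The linear map `A_J → kG_e` given by `a ↦ eae`. -/
def rhoA (heJ : e ∈ J.1) : AJ k J.1 →ₗ[k] MonoidAlgebra k (MaxSubgroup he) :=
  AJ.lift (rho k he) fun _ hs => rho_el_eq_zero k he heJ hs

theorem rhoA_toAJ (heJ : e ∈ J.1) (a : MonoidAlgebra k S) : rhoA k he heJ (toAJ k J.1 a) = rho k he a := rfl

theorem inclA_rhoA (heJ : e ∈ J.1) (a : AJ k J.1) :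
    inclA k J.1 he (rhoA k he heJ a) = elA k J.1 e * a * elA k J.1 e := by
  obtain ⟨a, rfl⟩ := toAJ_surjective k J.1 a
  rw [rhoA_toAJ, ← toAJ_el_mul_mul_el k he heJ, map_mul, map_mul, elA]

theorem rhoA_inclA (heJ : e ∈ J.1) (b : MonoidAlgebra k (MaxSubgroup he)) :
    rhoA k he heJ (inclA k J.1 he b) = b := rho_inclS k he b

theorem inclA_injective (heJ : e ∈ J.1) : Function.Injective (inclA k J.1 he) :=
  Function.LeftInverse.injective (rhoA_inclA k he heJ)

/-- The map `a ↦ eae` need not be multiplicative, but it is `kG_J`-linear on either side because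
`kG_J` absorbs `e`. This is what makes the maps between `V` and the induced and coinduced modules
well defined. -/
theorem rhoA_inclA_mul (heJ : e ∈ J.1) (b : MonoidAlgebra k (MaxSubgroup he)) (a : AJ k J.1) :
    rhoA k he heJ (inclA k J.1 he b * a) = b * rhoA k he heJ a := by
  apply inclA_injective k he heJ
  rw [map_mul (inclA k J.1 he), inclA_rhoA, inclA_rhoA, ← mul_assoc, ← mul_assoc, ← mul_assoc,
    elA_mul_inclA, inclA_mul_elA]

theorem rhoA_mul_inclA (heJ : e ∈ J.1) (a : AJ k J.1) (b : MonoidAlgebra k (MaxSubgroup he)) :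
    rhoA k he heJ (a * inclA k J.1 he b) = rhoA k he heJ a * b := by
  apply inclA_injective k he heJ
  rw [map_mul (inclA k J.1 he), inclA_rhoA, inclA_rhoA]
  simp only [mul_assoc]
  rw [elA_mul_inclA, inclA_mul_elA]

end Retraction

/-! ### Passing between `M` and `Me` -/

section Restriction

variable {k : Type*} [CommSemiring k] {S : Type*} [Semigroup S]
variable {M : Type*} [AddCommMonoid M] [Module k M] [RightModule k (MonoidAlgebra k S) M]
variable {N : Type*} [AddCommMonoid N] [Module k N] [RightModule k (MonoidAlgebra k S) N]
variable {e : S}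

variable (k M) in
/-- The elements of `notAbove J` act as zero on `M`. -/
def IsKilled (J : Set S) : Prop := ∀ s ∈ notAbove J, ∀ m : M, act k m (el k s) = 0

variable (k M e) in
/-- `M` is generated by `Me`. -/
def IsGenerated : Prop :=
  ∀ W : RSub k (MonoidAlgebra k S) M, (∀ m : M, act k m (el k e) ∈ W.toSubmodule) →
    ∀ m, m ∈ W.toSubmodule

/-- The action of `A_J` on a module killed by `notAbove J`. -/
def IsKilled.actA {J : Set S} (h : IsKilled k M J) : M →ₗ[k] AJ k J →ₗ[k] M :=
  LinearMap.mk₂ k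
    (fun m a => AJ.lift (RightModule.actHom (k := k) (A := MonoidAlgebra k S) m)
      (fun s hs => h s hs m) a)
    (by rintro m n ⟨a⟩; exact add_act k m n a)
    (by rintro c m ⟨a⟩; exact smul_act k c m a)
    (by intro m a b; exact map_add _ _ _)
    (by intro c m a; exact map_smul _ _ _)

theorem IsKilled.actA_toAJ {J : Set S} (h : IsKilled k M J) (m : M) (a : MonoidAlgebra k S) :
    h.actA m (toAJ k J a) = act k m a := rfl

theorem IsKilled.actA_mul {J : Set S} (h : IsKilled k M J) (m : M) (a b : AJ k J) :
    h.actA m (a * b) = h.actA (h.actA m a) b := by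
  obtain ⟨a, rfl⟩ := toAJ_surjective k J a
  obtain ⟨b, rfl⟩ := toAJ_surjective k J b
  rw [← map_mul]
  exact act_mul k m a b

variable (k M e) in
/-- The map `M → Me`, `m ↦ me`. -/
def toResE : M →ₗ[k] resE k e M :=
  LinearMap.rangeRestrict
    ((RightModule.actHom (k := k) (A := MonoidAlgebra k S) (M := M)).flip (el k e))

theorem coe_toResE (m : M) : (toResE k M e m : M) = act k m (el k e) := rfl

theorem coe_act_resE (he : IsIdempotentElem e) (m : resE k e M)
    (b : MonoidAlgebra k (MaxSubgroup he)) : (act k m b : resE k e M).1 = act k m.1 (inclS k he b) :=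
  rfl

theorem act_el_of_mem (he : IsIdempotentElem e) (m : resE k e M) :
    act k m.1 (el k e) = m.1 := by
  obtain ⟨_, m, rfl⟩ := m
  change act k (act k m (el k e)) (el k e) = act k m (el k e)
  rw [← act_mul, el_mul_el, he.eq]

theorem toResE_coe (he : IsIdempotentElem e) (m : resE k e M) : toResE k M e m.1 = m :=
  Subtype.ext (act_el_of_mem he m)

theorem act_resE_one (he : IsIdempotentElem e) (m : resE k e M) :
    act k m (1 : MonoidAlgebra k (MaxSubgroup he)) = m :=
  Subtype.ext (by rw [coe_act_resE, inclS_one, act_el_of_mem he])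

/-- Since `m = me`, one has `mae = m(eae)`, and `eae` agrees with `ρ(a)` in `A_J`, through which the
action factors. -/
theorem IsKilled.toResE_act [Finite S] (he : IsIdempotentElem e) {J : RegJClass S} (heJ : e ∈ J.1)
    (h : IsKilled k M J.1) (m : resE k e M) (a : MonoidAlgebra k S) :
    toResE k M e (act k m.1 a) = act k m (rho k he a) := by
  apply Subtype.ext
  rw [coe_toResE, coe_act_resE]
  conv_lhs => rw [← act_el_of_mem he m]
  rw [← act_mul, ← act_mul, ← mul_assoc, ← h.actA_toAJ, toAJ_el_mul_mul_el k he heJ]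
  rfl

/-- If `s` annihilates `M` but lies above `J`, then `e` is a multiple of `s` on both sides, and `Me
= 0`. So having apex `J` amounts to being killed by `I_J` with `Me ≠ 0`. -/
theorem hasApex_iff (he : IsIdempotentElem e) {J : RegJClass S} (heJ : e ∈ J.1) :
    HasApex k M J ↔ IsKilled k M J.1 ∧ ∃ m : M, act k m (el k e) ≠ 0 := by
  constructor
  · intro h
    refine ⟨fun s hs m => ?_, ?_⟩
    · rw [HasApex, Set.ext_iff] at h
      exact (h s).2 hs m
    · by_contra! hz
      have : e ∈ notAbove J.1 := by rw [← h]; exact hz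
      rw [RegJClass.mem_notAbove_iff heJ] at this
      exact this (self_mem_principalIdeal e)
  · rintro ⟨h, m, hm⟩
    refine Set.Subset.antisymm (fun s hs => ?_) fun s hs m => h s hs m
    rw [RegJClass.mem_notAbove_iff heJ]
    rintro ⟨p, q, hpq⟩
    obtain ⟨a, ha⟩ := exists_coe_eq_coe_mul e p
    obtain ⟨b, hb⟩ := exists_coe_eq_mul_coe e q
    -- Writing `e = eee` and replacing the middle factor by `p s q` gives `a = ep` and `b = qe` in
    -- `S` rather than in `S¹`.
    have hab : e = a * s * b := by
      apply WithOne.coe_injective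
      have h2 : (e : WithOne S) * e = e := by rw [← WithOne.coe_mul, he.eq]
      have h4 : (e : WithOne S) * e * e = e := by rw [h2, h2]
      conv_lhs => rw [← h4]
      conv_lhs => arg 1; arg 2; rw [hpq]
      simp only [WithOne.coe_mul, ha, hb, mul_assoc]
    apply hm
    rw [hab, ← el_mul_el, ← el_mul_el, act_mul, act_mul, hs (act k m (el k a)), zero_act]

/-- For nonzero `m` and any `n` in `Me`, minimality gives `n = ma`; then `n = ne = mae = mρ(a)`. -/
theorem IsMinimalModule.resE [Finite S] (he : IsIdempotentElem e) {J : RegJClass S} (heJ : e ∈ J.1)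
    (hJ : HasApex k M J) (h : IsMinimalModule k (MonoidAlgebra k S) M) :
    IsMinimalModule k (MonoidAlgebra k (MaxSubgroup he)) (resE k e M) := by
  obtain ⟨hk, m, hm⟩ := (hasApex_iff he heJ).1 hJ
  refine isMinimalModule_of_exists_act_eq ⟨toResE k M e m, 1, ?_⟩ fun m hm n => ?_
  · rw [act_resE_one]
    exact fun h0 => hm (congrArg Subtype.val h0)
  · obtain ⟨a, ha⟩ := h.exists_act_eq (m := m.1) (fun h0 => hm (Subtype.ext h0)) n.1
    exact ⟨rho k he a, by rw [← hk.toResE_act he heJ, ha, toResE_coe he]⟩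

theorem IsSimpleRightModule.resE [Finite S] (he : IsIdempotentElem e) {J : RegJClass S}
    (heJ : e ∈ J.1) (hJ : HasApex k M J) (h : IsSimpleRightModule k (MonoidAlgebra k S) M) :
    IsSimpleRightModule k (MonoidAlgebra k (MaxSubgroup he)) (resE k e M) := by
  obtain ⟨hk, m, hm⟩ := (hasApex_iff he heJ).1 hJ
  refine ⟨⟨toResE k M e m, 1, ?_⟩, fun R ⟨p, q, hpq⟩ m n hmn => ?_⟩
  · rw [act_resE_one]
    exact fun h0 => hm (congrArg Subtype.val h0)
  · by_contra hne
    -- The congruence on `M` coinduced from `R`. On `Me` it contains `R`, since `mae = mρ(a)`; being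
    -- nontrivial it is universal, and taking `a = e` shows that so is `R`.
    let R' : RCon k (MonoidAlgebra k S) M :=
      { r := fun u v => ∀ a : MonoidAlgebra k S,
          R.r (toResE k M e (act k u a)) (toResE k M e (act k v a))
        iseqv := ⟨fun _ _ => R.rel_refl _, fun h a => R.rel_symm (h a),
          fun h h' a => R.rel_trans (h a) (h' a)⟩
        add' := fun h h' a => by
          simp only [add_act, map_add]
          exact R.add' (h a) (h' a)
        smul := fun c _ _ h a => by
          simp only [smul_act, map_smul]
          exact R.smul c (h a)
        act_rel := fun u v b h a => by
          simp only [← act_mul]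
          exact h _ }
    have hR : R'.r m.1 n.1 := fun a => by
      rw [hk.toResE_act he heJ, hk.toResE_act he heJ]
      exact R.act_rel _ _ _ hmn
    have := h.rel R' hR (fun h0 => hne (Subtype.ext h0)) p.1 q.1 (el k e)
    rw [act_el_of_mem he, act_el_of_mem he, toResE_coe he, toResE_coe he] at this
    exact hpq this

theorem IsIrreducibleModule.resE [Finite S] (he : IsIdempotentElem e) {J : RegJClass S}
    (heJ : e ∈ J.1) (hJ : HasApex k M J) (h : IsIrreducibleModule k (MonoidAlgebra k S) M) :
    IsIrreducibleModule k (MonoidAlgebra k (MaxSubgroup he)) (resE k e M) :=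
  ⟨h.1.resE he heJ hJ, h.2.resE he heJ hJ⟩

theorem HasApex.congr {J : RegJClass S} (h : HasApex k M J)
    (i : Isomorphic k (MonoidAlgebra k S) M N) : HasApex k N J := by
  obtain ⟨f, hf⟩ := i
  rw [HasApex, ← h]
  ext s
  refine ⟨fun h m => f.injective ?_, fun h m => f.symm.injective ?_⟩
  · rw [hf, h, map_zero]
  · rw [map_zero, LinearEquiv.symm_apply_eq, map_zero]
    obtain ⟨m, rfl⟩ := f.surjective m
    rw [← hf, h m, map_zero]

theorem Isomorphic.resE (he : IsIdempotentElem e) (i : Isomorphic k (MonoidAlgebra k S) M N) :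
    Isomorphic k (MonoidAlgebra k (MaxSubgroup he)) (resE k e M) (resE k e N) := by
  obtain ⟨f, hf⟩ := i
  let g : SemiringRep.resE k e M →ₗ[k] SemiringRep.resE k e N :=
    (f.toLinearMap.comp (Submodule.subtype _)).codRestrict _ (by
      rintro ⟨_, m, rfl⟩
      exact ⟨f m, (hf m (el k e)).symm⟩)
  have hg : Function.Bijective g := by
    refine ⟨fun a b h => Subtype.ext (f.injective (congrArg Subtype.val h)), fun n => ?_⟩
    obtain ⟨_, n, rfl⟩ := n
    obtain ⟨m, rfl⟩ := f.surjective n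
    exact ⟨toResE k M e m, Subtype.ext (hf m (el k e))⟩
  exact ⟨LinearEquiv.ofBijective g hg, fun m b => Subtype.ext (hf m.1 (inclS k he b))⟩

variable (k M e) in
/-- The congruence `u ∼ v` iff `u a e = v a e` for all `a ∈ kS`. -/
def resN : RCon k (MonoidAlgebra k S) M where
  r u v := ∀ a : MonoidAlgebra k S, act k (act k u a) (el k e) = act k (act k v a) (el k e)
  iseqv := ⟨fun _ _ => rfl, fun h a => (h a).symm, fun h h' a => (h a).trans (h' a)⟩
  add' h h' a := by simp only [add_act, h a, h' a]
  smul c _ _ h a := by simp only [smul_act, h a]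
  act_rel u v b h a := by rw [← act_mul k _ b a, ← act_mul k _ b a]; exact h _

variable (k M e) in
/-- The submodule of all `m` with `m a e = 0` for all `a ∈ kS`. -/
def resK : RSub k (MonoidAlgebra k S) M where
  carrier := {m | ∀ a : MonoidAlgebra k S, act k (act k m a) (el k e) = 0}
  add_mem' h h' a := by simp only [add_act, h a, h' a, add_zero]
  zero_mem' a := by simp only [zero_act]
  smul_mem' c m h a := by simp only [smul_act, h a, smul_zero]
  act_mem m b h a := by rw [← act_mul k m b a]; exact h _

theorem mem_resK_iff {m : M} : m ∈ (resK k M e).toSubmodule ↔ (resN k M e).r m 0 := by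
  refine forall_congr' fun a => ?_
  rw [zero_act, zero_act]

theorem resN_resE_eq (he : IsIdempotentElem e) {m n : resE k e M} (h : (resN k M e).r m.1 n.1) :
    m = n := by
  have := h (el k e)
  simp only [act_el_of_mem he] at this
  exact Subtype.ext this

/-- If `m ∈ W` has `mae ≠ 0`, then `W ∩ Me` is a nonzero submodule of the minimal module `Me`; so
`W` contains `Me`, which generates `M`. -/
theorem RSub.le_resK (he : IsIdempotentElem e) (hgen : IsGenerated k M e)
    (h : IsMinimalModule k (MonoidAlgebra k (MaxSubgroup he)) (SemiringRep.resE k e M))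
    (W : RSub k (MonoidAlgebra k S) M) (hW : W.IsProper) : W ≤ resK k M e := by
  intro m hm a
  by_contra h0
  let W' : RSub k (MonoidAlgebra k (MaxSubgroup he)) (resE k e M) :=
    { toSubmodule := W.toSubmodule.comap (Submodule.subtype _)
      act_mem := fun m b hm => W.act_mem _ _ hm }
  refine hW (eq_top_iff.2 fun n _ => hgen W (fun n => ?_) n)
  exact h.eq_top W' (m := toResE k M e (act k m a)) (W.act_mem _ _ (W.act_mem _ _ hm))
    (fun h => h0 (congrArg Subtype.val h)) (toResE k M e n)

/-- If `R` relates `u`, `v` with `uae ≠ vae`, it is nontrivial on the simple module `Me` and hence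
relates all of `Me` to zero. -/
theorem RCon.le_resN (he : IsIdempotentElem e) (hgen : IsGenerated k M e)
    (h : IsSimpleRightModule k (MonoidAlgebra k (MaxSubgroup he)) (SemiringRep.resE k e M))
    (R : RCon k (MonoidAlgebra k S) M) (hR : R.IsProper) : R ≤ resN k M e := by
  intro u v huv a
  by_contra h0
  let R' : RCon k (MonoidAlgebra k (MaxSubgroup he)) (resE k e M) :=
    { r := fun m n => R.r m.1 n.1
      iseqv := ⟨fun _ => R.rel_refl _, fun h => R.rel_symm h, fun h h' => R.rel_trans h h'⟩
      add' := fun h h' => R.add' h h'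
      smul := fun c _ _ h => R.smul c h
      act_rel := fun _ _ _ h => R.act_rel _ _ _ h }
  -- The class of zero is a submodule; it contains the generating part `Me`, so every element is
  -- related to zero and `R` is not proper.
  let W : RSub k (MonoidAlgebra k S) M :=
    { carrier := {m | R.r m 0}
      add_mem' := fun {m n} h h' => by
        have := R.add' h h'
        rwa [add_zero] at this
      zero_mem' := R.rel_refl _
      smul_mem' := fun c m h => by
        have := R.smul c h
        rwa [smul_zero] at this
      act_mem := fun m a h => by
        have := R.act_rel _ _ a h
        rwa [zero_act] at this }
  have hW : ∀ m, R.r m 0 := hgen W fun m =>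
    h.rel R' (m := toResE k M e (act k u a)) (n := toResE k M e (act k v a))
      (R.act_rel _ _ _ (R.act_rel _ _ _ huv)) (fun h => h0 (congrArg Subtype.val h))
      (toResE k M e m) 0
  obtain ⟨p, q, hpq⟩ := hR
  exact hpq (R.rel_trans (hW p) (R.rel_symm (hW q)))

theorem ActsNonzero.exists_ne_zero {A : Type*} [NonUnitalSemiring A] [Module k A]
    {M : Type*} [AddCommMonoid M] [Module k M] [RightModule k A M]
    (h : ActsNonzero k A M) : ∃ m : M, m ≠ 0 := by
  obtain ⟨m, a, h⟩ := h
  exact ⟨_, h⟩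

theorem resN_isProper (he : IsIdempotentElem e) (h : ∃ m : resE k e M, m ≠ 0) :
    (resN k M e).IsProper := by
  obtain ⟨m, hm⟩ := h
  exact ⟨m.1, (0 : SemiringRep.resE k e M).1, fun h => hm (resN_resE_eq he h)⟩

theorem resK_isProper (he : IsIdempotentElem e) (h : ∃ m : resE k e M, m ≠ 0) :
    (resK k M e).IsProper := by
  obtain ⟨m, hm⟩ := h
  intro ht
  have h1 : m.1 ∈ (resK k M e).toSubmodule := ht ▸ trivial
  exact hm (resN_resE_eq he (mem_resK_iff.1 h1))

theorem maximal_iff_eq_resK (he : IsIdempotentElem e) (hgen : IsGenerated k M e)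
    (h : IsMinimalModule k (MonoidAlgebra k (MaxSubgroup he)) (SemiringRep.resE k e M))
    (W : RSub k (MonoidAlgebra k S) M) : Maximal RSub.IsProper W ↔ W = resK k M e :=
  maximal_iff_of_forall_le _ _ (resK_isProper he h.1.exists_ne_zero) (RSub.le_resK he hgen h)
    (fun _ _ => RSub.le_antisymm) W

theorem maximal_iff_eq_resN (he : IsIdempotentElem e) (hgen : IsGenerated k M e)
    (h : IsSimpleRightModule k (MonoidAlgebra k (MaxSubgroup he)) (SemiringRep.resE k e M))
    (R : RCon k (MonoidAlgebra k S) M) : Maximal RCon.IsProper R ↔ R = resN k M e :=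
  maximal_iff_of_forall_le _ _ (resN_isProper he h.1.exists_ne_zero) (RCon.le_resN he hgen h)
    (fun _ _ => RCon.le_antisymm) R

variable {R : RCon k (MonoidAlgebra k S) M}

/-- A congruence inside `resN` separates the points of `Me` (take `a = e`), so the quotient does not
change the `e`-part. -/
theorem RCon.resE_quotient (he : IsIdempotentElem e) (hR : R ≤ resN k M e) :
    Isomorphic k (MonoidAlgebra k (MaxSubgroup he)) (resE k e R.toModuleCon.Quotient)
      (resE k e M) := by
  let g : SemiringRep.resE k e M →ₗ[k] SemiringRep.resE k e R.toModuleCon.Quotient :=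
    (R.proj.comp (Submodule.subtype _)).codRestrict _ (by
      rintro ⟨_, m, rfl⟩
      exact ⟨R.proj m, rfl⟩)
  have hg : Function.Bijective g := by
    refine ⟨fun a b h => ?_, fun n => ?_⟩
    · exact resN_resE_eq he (hR _ _ (R.proj_eq_proj_iff.1 (congrArg Subtype.val h)))
    · obtain ⟨_, n, rfl⟩ := n
      obtain ⟨m, rfl⟩ := R.proj_surjective n
      exact ⟨toResE k M e m, rfl⟩
  exact Isomorphic.symm ⟨LinearEquiv.ofBijective g hg, fun m b => rfl⟩

theorem IsKilled.quotient {J : Set S} (h : IsKilled k M J) :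
    IsKilled k R.toModuleCon.Quotient J := by
  intro s hs m
  obtain ⟨m, rfl⟩ := R.proj_surjective m
  rw [← R.proj_act, h s hs, map_zero]

theorem exists_act_el_ne_zero (he : IsIdempotentElem e) (h : ∃ m : resE k e M, m ≠ 0) :
    ∃ m : M, act k m (el k e) ≠ 0 := by
  obtain ⟨m, hm⟩ := h
  exact ⟨m.1, by rw [act_el_of_mem he]; exact fun h => hm (Subtype.ext h)⟩

theorem IsKilled.hasApex (he : IsIdempotentElem e) {J : RegJClass S} (heJ : e ∈ J.1)
    (hk : IsKilled k M J.1) (h : ActsNonzero k (MonoidAlgebra k (MaxSubgroup he)) (SemiringRep.resE k e M)) :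
    HasApex k M J :=
  (hasApex_iff he heJ).2 ⟨hk, exists_act_el_ne_zero he h.exists_ne_zero⟩

/-- A proper submodule of the quotient has proper preimage, which lies in `resK`; `R` collapses
`resK` to zero. -/
theorem RCon.isMinimalModule_quotient (he : IsIdempotentElem e) (hgen : IsGenerated k M e)
    (h : IsMinimalModule k (MonoidAlgebra k (MaxSubgroup he)) (SemiringRep.resE k e M))
    (hR : R ≤ resN k M e) (hK : ∀ m ∈ (resK k M e).toSubmodule, R.r m 0) :
    IsMinimalModule k (MonoidAlgebra k S) R.toModuleCon.Quotient := by
  have h1 := h.congr (R.resE_quotient he hR).symm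
  obtain ⟨m, hm⟩ := exists_act_el_ne_zero he h1.1.exists_ne_zero
  refine ⟨⟨m, _, hm⟩, fun W hW hW0 => hW0 ?_⟩
  have hle : W.comap R.proj R.proj_act ≤ resK k M e := by
    refine RSub.le_resK he hgen h _ fun ht => hW (eq_top_iff.2 fun n _ => ?_)
    obtain ⟨m, rfl⟩ := R.proj_surjective n
    have : m ∈ (W.comap R.proj R.proj_act).toSubmodule := ht ▸ trivial
    exact this
  rw [eq_bot_iff]
  intro n hn
  obtain ⟨m, rfl⟩ := R.proj_surjective n
  have := R.proj_eq_proj_iff.2 (hK m (hle hn))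
  rw [map_zero] at this
  exact this

theorem RCon.isSimpleRightModule_quotient
    (h : ActsNonzero k (MonoidAlgebra k S) R.toModuleCon.Quotient)
    (hR : ∀ R' : RCon k (MonoidAlgebra k S) M, R'.IsProper → R' ≤ R) :
    IsSimpleRightModule k (MonoidAlgebra k S) R.toModuleCon.Quotient := by
  refine ⟨h, fun R' ⟨p, q, hpq⟩ m n hmn => ?_⟩
  obtain ⟨p, rfl⟩ := R.proj_surjective p
  obtain ⟨q, rfl⟩ := R.proj_surjective q
  obtain ⟨m, rfl⟩ := R.proj_surjective m
  obtain ⟨n, rfl⟩ := R.proj_surjective n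
  exact R.proj_eq_proj_iff.2 (hR (R'.comap R.proj R.proj_act) ⟨p, q, hpq⟩ m n hmn)

theorem isIrreducibleModule_quotient_resN (he : IsIdempotentElem e) (hgen : IsGenerated k M e)
    (h : IsIrreducibleModule k (MonoidAlgebra k (MaxSubgroup he)) (resE k e M)) :
    IsIrreducibleModule k (MonoidAlgebra k S) (resN k M e).toModuleCon.Quotient := by
  have hmin := RCon.isMinimalModule_quotient he hgen h.2 (R := resN k M e)
    (fun _ _ h => h) (fun m hm => mem_resK_iff.1 hm)
  exact ⟨RCon.isSimpleRightModule_quotient hmin.1 (RCon.le_resN he hgen h.1), hmin⟩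

/-- A module that is generated by `Me` and has trivial `resN` is irreducible if `Me` is. -/
theorem isIrreducibleModule_of_resE (he : IsIdempotentElem e) (hgen : IsGenerated k M e)
    (hN : (resN k M e).IsTrivial)
    (h : IsIrreducibleModule k (MonoidAlgebra k (MaxSubgroup he)) (resE k e M)) :
    IsIrreducibleModule k (MonoidAlgebra k S) M := by
  obtain ⟨m, hm⟩ := exists_act_el_ne_zero he h.1.1.exists_ne_zero
  refine ⟨⟨⟨m, _, hm⟩, fun R hR p q hpq => hN _ _ (RCon.le_resN he hgen h.1 R hR _ _ hpq)⟩,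
    ⟨m, _, hm⟩, fun W hW hW0 => hW0 (eq_bot_iff.2 fun p hp => ?_)⟩
  exact hN _ _ (mem_resK_iff.1 (RSub.le_resK he hgen h.2 W hW hp))

theorem IsSimpleRightModule.resN_isTrivial (he : IsIdempotentElem e) {J : RegJClass S}
    (heJ : e ∈ J.1) (hJ : HasApex k M J) (h : IsSimpleRightModule k (MonoidAlgebra k S) M) :
    (resN k M e).IsTrivial := by
  obtain ⟨m, hm⟩ := ((hasApex_iff he heJ).1 hJ).2
  exact h.2 _ (resN_isProper he ⟨toResE k M e m, fun h => hm (congrArg Subtype.val h)⟩)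

end Restriction

end

noncomputable section

/-- Modules are not assumed unital, but a nonzero `v` in a minimal module is `va` for some `a`, so
`v1 = v(a1) = va = v`. -/
theorem IsMinimalModule.act_one {k : Type*} [CommSemiring k] {G : Type*} [Monoid G] {V : Type*}
    [AddCommMonoid V] [Module k V] [RightModule k (MonoidAlgebra k G) V]
    (h : IsMinimalModule k (MonoidAlgebra k G) V) (v : V) :
    act k v (1 : MonoidAlgebra k G) = v := by
  by_cases hv : v = 0
  · rw [hv, zero_act]
  · obtain ⟨a, ha⟩ := h.exists_act_eq hv v
    conv_rhs => rw [← ha, ← mul_one a, act_mul, ha]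

/-! ### The induced module and its quotients -/

section Induction

variable {k : Type*} [CommSemiring k] {S : Type*} [Semigroup S] {J : RegJClass S}
variable {e : S} (he : IsIdempotentElem e)
variable {V : Type*} [AddCommMonoid V] [Module k V]
  [RightModule k (MonoidAlgebra k (MaxSubgroup he)) V]
variable {M : Type*} [AddCommMonoid M] [Module k M] [RightModule k (MonoidAlgebra k S) M]

variable (k J) in
/-- The class of `e` in `e A_J`. -/
def eAOne : eA k J.1 e := ⟨elA k J.1 e, elA k J.1 e, elA_mul_elA k he J.1⟩

theorem act_eAOne (z : eA k J.1 e) : act k (eAOne k J he) z.1 = z := by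
  obtain ⟨_, y, rfl⟩ := z
  apply Subtype.ext
  change elA k J.1 e * (elA k J.1 e * y) = elA k J.1 e * y
  rw [← mul_assoc, elA_mul_elA k he]

variable (k J V) in
/-- The projection `V ⊗ e A_J → Ind_J(V)`. -/
def IndJ.proj : V ⊗[k] eA k J.1 e →ₗ[k] IndJ k J.1 he V where
  toFun := Quotient.mk (indCon k J.1 he V).toSetoid
  map_add' _ _ := rfl
  map_smul' _ _ := rfl

theorem IndJ.proj_surjective : Function.Surjective (IndJ.proj k J he V) := Quotient.mk_surjective

theorem IndJ.proj_balanced (v : V) (b : MonoidAlgebra k (MaxSubgroup he)) (z : eA k J.1 e) :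
    IndJ.proj k J he V (act k v b ⊗ₜ[k] z) = IndJ.proj k J he V (v ⊗ₜ[k] groupMul k J.1 he b z) :=
  Quotient.sound (s := (indCon k J.1 he V).toSetoid) (AddConGen.Rel.of _ _ (BalancedRel.mk v b z))

theorem IndJ.act_proj (v : V) (z : eA k J.1 e) (a : AJ k J.1) :
    act k (IndJ.proj k J he V (v ⊗ₜ[k] z)) a = IndJ.proj k J he V (v ⊗ₜ[k] act k z a) := rfl

theorem IndJ.act_toAJ (m : IndJ k J.1 he V) (a : MonoidAlgebra k S) :
    act k m a = act k m (toAJ k J.1 a) := rfl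

@[elab_as_elim]
theorem IndJ.induction {p : IndJ k J.1 he V → Prop} (zero : p 0)
    (tmul : ∀ v z, p (IndJ.proj k J he V (v ⊗ₜ[k] z)))
    (add : ∀ m n, p m → p n → p (m + n)) (m : IndJ k J.1 he V) : p m := by
  obtain ⟨t, rfl⟩ := IndJ.proj_surjective he m
  induction t using TensorProduct.induction_on with
  | zero => rwa [map_zero]
  | tmul v z => exact tmul v z
  | add s t hs ht => rw [map_add]; exact add _ _ hs ht

/-- A balanced linear map on `V ⊗ e A_J` descends to `Ind_J(V)`. -/
def IndJ.lift {P : Type*} [AddCommMonoid P] [Module k P] (F : V ⊗[k] eA k J.1 e →ₗ[k] P)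
    (hF : ∀ (v : V) (b : MonoidAlgebra k (MaxSubgroup he)) (z : eA k J.1 e),
      F (act k v b ⊗ₜ[k] z) = F (v ⊗ₜ[k] groupMul k J.1 he b z)) : IndJ k J.1 he V →ₗ[k] P where
  toFun := Quotient.lift F (by
    intro s t h
    have key : addConGen (BalancedRel k J.1 he V) ≤ AddCon.ker F.toAddMonoidHom := by
      refine AddCon.addConGen_le.2 ?_
      rintro _ _ ⟨v, b, z⟩
      exact hF v b z
    exact key h)
  map_add' := by rintro ⟨a⟩ ⟨b⟩; exact map_add F a b
  map_smul' := by rintro c ⟨a⟩; exact map_smul F c a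

theorem IndJ.isKilled : IsKilled k (IndJ k J.1 he V) J.1 := by
  intro s hs m
  rw [IndJ.act_toAJ, toAJ_el_eq_zero k hs, act_zero]

/-- The `kS`-action factors through the surjection onto `A_J`, so testing against `A_J` or `kS` is
the same. This brings `Ind_J(V)` under the general results on `resN`. -/
theorem indN_eq_resN : indN k J.1 he V = resN k (IndJ k J.1 he V) e := by
  refine RCon.ext fun m n => ⟨fun h a => h (toAJ k J.1 a), fun h a => ?_⟩
  obtain ⟨a, rfl⟩ := toAJ_surjective k J.1 a
  exact h a

theorem indK_eq_resK : indK k J.1 he V = resK k (IndJ k J.1 he V) e := by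
  refine RSub.ext (Submodule.ext fun m => ⟨fun h a => h (toAJ k J.1 a), fun h a => ?_⟩)
  obtain ⟨a, rfl⟩ := toAJ_surjective k J.1 a
  exact h a

/-- Indeed `v ⊗ z = (v ⊗ e) z`, and `v ⊗ e` is fixed by `e`. -/
theorem IndJ.isGenerated : IsGenerated k (IndJ k J.1 he V) e := by
  intro W hW m
  induction m using IndJ.induction he with
  | zero => exact W.toSubmodule.zero_mem
  | add m n hm hn => exact W.toSubmodule.add_mem hm hn
  | tmul v z =>
    obtain ⟨a, ha⟩ := toAJ_surjective k J.1 z.1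
    have h := W.act_mem _ a (hW (IndJ.proj k J he V (v ⊗ₜ[k] eAOne k J he)))
    rw [IndJ.act_toAJ, IndJ.act_toAJ, IndJ.act_proj, IndJ.act_proj, ha] at h
    have h2 : act k (eAOne k J he) (toAJ k J.1 (el k e)) = eAOne k J he := act_eAOne he (eAOne k J he)
    rwa [h2, act_eAOne] at h

variable [Finite S] (heJ : e ∈ J.1)

variable (k V) in
/-- The map `Ind_J(V) → V`, `v ⊗ z ↦ v (z e)`. -/
def IndJ.toV : IndJ k J.1 he V →ₗ[k] V :=
  IndJ.lift he (TensorProduct.lift (LinearMap.mk₂ k (fun v (z : eA k J.1 e) =>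
      act k v (rhoA k he heJ z.1))
    (fun _ _ _ => add_act k _ _ _)
    (fun _ _ _ => smul_act k _ _ _)
    (fun _ _ _ => by rw [Submodule.coe_add, map_add, act_add])
    (fun _ _ _ => by rw [Submodule.coe_smul, map_smul, act_smul]))) (by
      intro v b z
      change act k (act k v b) (rhoA k he heJ z.1) = act k v (rhoA k he heJ (inclA k J.1 he b * z.1))
      rw [rhoA_inclA_mul, act_mul])

theorem IndJ.toV_proj (v : V) (z : eA k J.1 e) :
    IndJ.toV k he V heJ (IndJ.proj k J he V (v ⊗ₜ[k] z)) = act k v (rhoA k he heJ z.1) := rfl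

theorem rhoA_elA : rhoA k he heJ (elA k J.1 e) = 1 := by
  rw [elA, ← inclS_one k he]
  exact rhoA_inclA k he heJ 1

/-- For `z ∈ e A_J`, `ze = eze` comes from `kG_J` and crosses the tensor sign, so `v ⊗ ze = v(eze) ⊗
e`. Thus the `e`-part consists of tensors `v ⊗ e`. -/
theorem IndJ.act_el (m : IndJ k J.1 he V) :
    act k m (el k e) = IndJ.proj k J he V (IndJ.toV k he V heJ m ⊗ₜ[k] eAOne k J he) := by
  induction m using IndJ.induction he with
  | zero => rw [zero_act, map_zero, TensorProduct.zero_tmul, map_zero]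
  | add m n hm hn => rw [add_act, map_add, TensorProduct.add_tmul, map_add, hm, hn]
  | tmul v z =>
    rw [IndJ.toV_proj, IndJ.proj_balanced, IndJ.act_toAJ, IndJ.act_proj]
    congr 2
    apply Subtype.ext
    obtain ⟨_, y, rfl⟩ := z
    change elA k J.1 e * y * elA k J.1 e = inclA k J.1 he (rhoA k he heJ (elA k J.1 e * y)) * elA k J.1 e
    rw [inclA_rhoA, ← mul_assoc, elA_mul_elA k he, mul_assoc (elA k J.1 e * y), elA_mul_elA k he]

include heJ in
theorem IndJ.resE_isomorphic (hV : ∀ v : V, act k v (1 : MonoidAlgebra k (MaxSubgroup he)) = v) :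
    Isomorphic k (MonoidAlgebra k (MaxSubgroup he)) (resE k e (IndJ k J.1 he V)) V := by
  have hmem : ∀ v : V, act k (IndJ.proj k J he V (v ⊗ₜ[k] eAOne k J he)) (el k e) =
      IndJ.proj k J he V (v ⊗ₜ[k] eAOne k J he) := fun v => by
    rw [IndJ.act_el he heJ, IndJ.toV_proj, eAOne, rhoA_elA, hV]
  let g : V →ₗ[k] resE k e (IndJ k J.1 he V) :=
    ((IndJ.proj k J he V).comp ((TensorProduct.mk k V (eA k J.1 e)).flip (eAOne k J he))).codRestrict
      _ (fun v => ⟨IndJ.proj k J he V (v ⊗ₜ[k] eAOne k J he), hmem v⟩)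
  have hg : Function.Bijective g := by
    refine ⟨fun v v' h => ?_, fun m => ?_⟩
    · have := congrArg (fun m => IndJ.toV k he V heJ m.1) h
      change act k v (rhoA k he heJ (elA k J.1 e)) = act k v' (rhoA k he heJ (elA k J.1 e)) at this
      rwa [rhoA_elA, hV, hV] at this
    · refine ⟨IndJ.toV k he V heJ m.1, Subtype.ext ?_⟩
      rw [← act_el_of_mem he m, IndJ.act_el he heJ m.1]
      change IndJ.proj k J he V _ = IndJ.proj k J he V _
      rw [IndJ.toV_proj, eAOne, rhoA_elA, hV]
      rfl
  refine Isomorphic.symm ⟨LinearEquiv.ofBijective g hg, fun v b => Subtype.ext ?_⟩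
  change IndJ.proj k J he V (act k v b ⊗ₜ[k] eAOne k J he) =
    IndJ.proj k J he V (v ⊗ₜ[k] act k (eAOne k J he) (inclA k J.1 he b))
  rw [IndJ.proj_balanced]
  congr 2
  apply Subtype.ext
  change inclA k J.1 he b * elA k J.1 e = elA k J.1 e * inclA k J.1 he b
  rw [elA_mul_inclA, inclA_mul_elA]

/-- The homomorphism `Ind_J(V) → M` extending a homomorphism `V → Me`. -/
def IndJ.extend (hM : IsKilled k M J.1) (φ : V →ₗ[k] M)
    (hφ : ∀ (v : V) (b : MonoidAlgebra k (MaxSubgroup he)), φ (act k v b) = act k (φ v) (inclS k he b)) :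
    IndJ k J.1 he V →ₗ[k] M :=
  IndJ.lift he (TensorProduct.lift ((hM.actA.comp φ).compl₂ (Submodule.subtype (eA k J.1 e)))) (by
    intro v b z
    change hM.actA (φ (act k v b)) z.1 = hM.actA (φ v) (inclA k J.1 he b * z.1)
    rw [hφ, hM.actA_mul]
    rfl)

omit [Finite S] in
theorem IndJ.extend_act (hM : IsKilled k M J.1) (φ : V →ₗ[k] M)
    (hφ : ∀ (v : V) (b : MonoidAlgebra k (MaxSubgroup he)), φ (act k v b) = act k (φ v) (inclS k he b))
    (m : IndJ k J.1 he V) (a : MonoidAlgebra k S) :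
    IndJ.extend he hM φ hφ (act k m a) = act k (IndJ.extend he hM φ hφ m) a := by
  induction m using IndJ.induction he with
  | zero => rw [zero_act, map_zero, zero_act]
  | add m n hm hn => rw [add_act, map_add, map_add, add_act, hm, hn]
  | tmul v z => exact hM.actA_mul (φ v) z.1 (toAJ k J.1 a)

include heJ in
-- Extend `φ : V ≅ Me` by `v ⊗ z ↦ φ(v)z`. The image is a nonzero submodule of a minimal module,
-- hence everything. The map is injective on the `e`-part `V ⊗ e`, so its kernel lies in `N`.
theorem IndJ.exists_surjective (hJ : HasApex k M J) (hM : IsMinimalModule k (MonoidAlgebra k S) M)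
    (hV : IsMinimalModule k (MonoidAlgebra k (MaxSubgroup he)) V)
    (i : Isomorphic k (MonoidAlgebra k (MaxSubgroup he)) (resE k e M) V) :
    ∃ (f : IndJ k J.1 he V →ₗ[k] M)
      (_ : ∀ m (a : MonoidAlgebra k S), f (act k m a) = act k (f m) a),
      Function.Surjective f ∧ ∀ m n, f m = f n → (indN k J.1 he V).r m n := by
  obtain ⟨φ, hφ⟩ := i.symm
  have hk := ((hasApex_iff he heJ).1 hJ).1
  set f := IndJ.extend he hk ((Submodule.subtype _).comp φ.toLinearMap)
    (fun v b => congrArg Subtype.val (hφ v b)) with hf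
  have hfe : ∀ v : V, f (IndJ.proj k J he V (v ⊗ₜ[k] eAOne k J he)) = (φ v).1 := fun v =>
    act_el_of_mem he (φ v)
  have hact := IndJ.extend_act he hk ((Submodule.subtype _).comp φ.toLinearMap)
    (fun v b => congrArg Subtype.val (hφ v b))
  rw [← hf] at hact
  refine ⟨f, hact, ?_, fun m n hmn => ?_⟩
  · obtain ⟨v, hv⟩ := hV.1.exists_ne_zero
    have := hM.eq_top ((RSub.univ k _ _).map f hact) (m := (φ v).1)
      ⟨_, trivial, hfe v⟩ (fun h => hv (by
        rwa [ZeroMemClass.coe_eq_zero, LinearEquiv.map_eq_zero_iff] at h))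
    intro n
    obtain ⟨m, -, hm⟩ := this n
    exact ⟨m, hm⟩
  · rw [indN_eq_resN]
    intro a
    have h : f (act k (act k m a) (el k e)) = f (act k (act k n a) (el k e)) := by
      simp only [hact, hmn]
    rw [IndJ.act_el he heJ, IndJ.act_el he heJ] at h ⊢
    rw [hfe, hfe] at h
    rw [φ.injective (Subtype.ext h)]

include heJ in
theorem IndModN.isIrreducibleModule (hV : IsIrreducibleModule k (MonoidAlgebra k (MaxSubgroup he)) V) :
    IsIrreducibleModule k (MonoidAlgebra k S) (IndModN k J.1 he V) ∧
      HasApex k (IndModN k J.1 he V) J ∧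
      Isomorphic k (MonoidAlgebra k (MaxSubgroup he)) (resE k e (IndModN k J.1 he V)) V := by
  unfold IndModN
  rw [indN_eq_resN]
  have i := IndJ.resE_isomorphic he heJ hV.2.act_one
  have i' := (RCon.resE_quotient he (R := resN k (IndJ k J.1 he V) e) (fun _ _ h => h)).trans i
  exact ⟨isIrreducibleModule_quotient_resN he (IndJ.isGenerated he) (hV.congr i.symm),
    (IndJ.isKilled he).quotient.hasApex he heJ (hV.congr i'.symm).1.1, i'⟩

include heJ in
theorem IndModN.isomorphic (hV : IsIrreducibleModule k (MonoidAlgebra k (MaxSubgroup he)) V)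
    (hM : IsIrreducibleModule k (MonoidAlgebra k S) M) (hJ : HasApex k M J)
    (i : Isomorphic k (MonoidAlgebra k (MaxSubgroup he)) (resE k e M) V) :
    Isomorphic k (MonoidAlgebra k S) M (IndModN k J.1 he V) := by
  obtain ⟨f, hf, hs, hN⟩ := IndJ.exists_surjective he heJ hJ hM.2 hV.2 i
  -- The kernel is all of `N`: `f` carries `N`-related elements to `resN`-related ones, and `resN`
  -- is trivial on the simple module `M`.
  have h : (RCon.eq k (MonoidAlgebra k S) M).comap f hf = indN k J.1 he V := by
    refine RCon.le_antisymm hN fun m n hmn => ?_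
    refine hM.1.resN_isTrivial he heJ hJ _ _ fun a => ?_
    rw [indN_eq_resN] at hmn
    simp only [← hf]
    exact congrArg f (hmn a)
  unfold IndModN
  rw [← h]
  exact isomorphic_quotient_ker f hf hs

include heJ in
theorem isMinimalModule_iff_exists_quotient_indJ
    (hV : IsMinimalModule k (MonoidAlgebra k (MaxSubgroup he)) V) :
    (IsMinimalModule k (MonoidAlgebra k S) M ∧ HasApex k M J ∧
      Isomorphic k (MonoidAlgebra k (MaxSubgroup he)) (resE k e M) V) ↔
    ∃ R : RCon k (MonoidAlgebra k S) (IndJ k J.1 he V), R ≤ indN k J.1 he V ∧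
      (∀ p ∈ (indK k J.1 he V).toSubmodule, ∀ q ∈ (indK k J.1 he V).toSubmodule, R.r p q) ∧
      Isomorphic k (MonoidAlgebra k S) M R.toModuleCon.Quotient := by
  constructor
  · rintro ⟨hM, hJ, i⟩
    obtain ⟨f, hf, hs, hN⟩ := IndJ.exists_surjective he heJ hJ hM hV i
    refine ⟨_, hN, fun p hp q hq => ?_, isomorphic_quotient_ker f hf hs⟩
    -- The map sends `K` into `resK` of `M`, a proper submodule since `Me ≠ 0`, hence zero by
    -- minimality.
    have hK : ∀ p ∈ (indK k J.1 he V).toSubmodule, f p = 0 := fun p hp => by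
      by_contra h0
      refine resK_isProper (k := k) (M := M) he (hV.congr i.symm).1.exists_ne_zero
        (eq_top_iff.2 fun n _ => hM.eq_top (resK k M e) (m := f p) (fun a => ?_) h0 n)
      rw [indK_eq_resK] at hp
      rw [← hf, ← hf, hp a, map_zero]
    exact (hK p hp).trans (hK q hq).symm
  · rintro ⟨R, hR, hK, i⟩
    rw [indN_eq_resN] at hR
    rw [indK_eq_resK] at hK
    have j := IndJ.resE_isomorphic he heJ hV.act_one
    have j' := (RCon.resE_quotient he hR).trans j
    refine ⟨(RCon.isMinimalModule_quotient he (IndJ.isGenerated he) (hV.congr j.symm) hR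
      fun m hm => hK m hm 0 (Submodule.zero_mem _)).congr i.symm, ?_, (i.resE he).trans j'⟩
    exact ((IndJ.isKilled he).quotient.hasApex he heJ (hV.congr j'.symm).1).congr i.symm

end Induction

end

noncomputable section

/-! ### The coinduced module and its least nonzero submodule -/

section Coinduction

variable {k : Type*} [CommSemiring k] {S : Type*} [Semigroup S] {J : RegJClass S}
variable {e : S} (he : IsIdempotentElem e)
variable {V : Type*} [AddCommMonoid V] [Module k V]
  [RightModule k (MonoidAlgebra k (MaxSubgroup he)) V]
variable {M : Type*} [AddCommMonoid M] [Module k M] [RightModule k (MonoidAlgebra k S) M]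

variable (k J) in
/-- The class of `e` in `A_J e`. -/
def AeOne : Ae k J.1 e := ⟨elA k J.1 e, elA k J.1 e, elA_mul_elA k he J.1⟩

theorem CoindJ.ext {f g : CoindJ k J.1 he V} (h : ∀ z : Ae k J.1 e, f.1 z = g.1 z) : f = g :=
  Subtype.ext (LinearMap.ext h)

theorem CoindJ.act_apply (f : CoindJ k J.1 he V) (a : MonoidAlgebra k S) (z : Ae k J.1 e) :
    (act k f a).1 z = f.1 (leftMulAe k J.1 (toAJ k J.1 a) z) := rfl

theorem CoindJ.isKilled : IsKilled k (CoindJ k J.1 he V) J.1 := by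
  intro s hs f
  change act k f (toAJ k J.1 (el k s)) = 0
  rw [toAJ_el_eq_zero k hs, act_zero]

theorem CoindL.isKilled : IsKilled k (CoindL k J.1 he V) J.1 :=
  fun s hs m => Subtype.ext (CoindJ.isKilled he s hs m.1)

variable [Finite S] (heJ : e ∈ J.1)

/-- The element `z ↦ v (e z)` of `Coind_J(V)`. -/
def CoindJ.ofV : V →ₗ[k] CoindJ k J.1 he V where
  toFun v := ⟨((RightModule.actHom (k := k) (A := MonoidAlgebra k (MaxSubgroup he)) v).comp
      (rhoA k he heJ)).comp (Submodule.subtype _), fun z b => by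
    change act k v (rhoA k he heJ (z.1 * inclA k J.1 he b)) = act k (act k v (rhoA k he heJ z.1)) b
    rw [rhoA_mul_inclA, act_mul]⟩
  map_add' v w := CoindJ.ext he fun z => add_act k v w _
  map_smul' c v := CoindJ.ext he fun z => smul_act k c v _

theorem CoindJ.ofV_apply (v : V) (z : Ae k J.1 e) :
    (CoindJ.ofV he heJ v : CoindJ k J.1 he V).1 z = act k v (rhoA k he heJ z.1) := rfl

theorem CoindJ.ofV_act (v : V) (b : MonoidAlgebra k (MaxSubgroup he)) :
    act k (CoindJ.ofV he heJ v : CoindJ k J.1 he V) (inclS k he b) =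
      CoindJ.ofV he heJ (act k v b) := by
  refine CoindJ.ext he fun z => ?_
  change act k v (rhoA k he heJ (inclA k J.1 he b * z.1)) = act k (act k v b) (rhoA k he heJ z.1)
  rw [rhoA_inclA_mul, act_mul]

/-- For `z = ye` one has `ez = e(eye)` with `eye` coming from `kG_J`, so equivariance gives `f(ez) =
f(e)(eye)`. Thus `fe` depends only on the value `f(e)`. -/
theorem CoindJ.act_el (f : CoindJ k J.1 he V) :
    act k f (el k e) = CoindJ.ofV he heJ (f.1 (AeOne k J he)) := by
  refine CoindJ.ext he fun z => ?_
  rw [CoindJ.ofV_apply, CoindJ.act_apply, ← f.2]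
  congr 1
  apply Subtype.ext
  obtain ⟨_, y, rfl⟩ := z
  change elA k J.1 e * (y * elA k J.1 e) =
    elA k J.1 e * inclA k J.1 he (rhoA k he heJ (y * elA k J.1 e))
  rw [inclA_rhoA]
  simp only [mul_assoc, elA_mul_elA k he]
  rw [← mul_assoc (elA k J.1 e) (elA k J.1 e), elA_mul_elA k he]

theorem CoindJ.ofV_one (hV : ∀ v : V, act k v (1 : MonoidAlgebra k (MaxSubgroup he)) = v) (v : V) :
    (CoindJ.ofV he heJ v : CoindJ k J.1 he V).1 (AeOne k J he) = v := by
  rw [CoindJ.ofV_apply, AeOne, rhoA_elA, hV]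

theorem CoindJ.ofV_act_el (v : V) (hV : ∀ v : V, act k v (1 : MonoidAlgebra k (MaxSubgroup he)) = v) :
    act k (CoindJ.ofV he heJ v : CoindJ k J.1 he V) (el k e) = CoindJ.ofV he heJ v := by
  rw [CoindJ.act_el he heJ, CoindJ.ofV_one he heJ hV]

theorem CoindJ.act_act_el (f : CoindJ k J.1 he V) (y : MonoidAlgebra k S) :
    act k (act k f y) (el k e) =
      CoindJ.ofV he heJ (f.1 ⟨toAJ k J.1 y * elA k J.1 e, toAJ k J.1 y, rfl⟩) := by
  rw [CoindJ.act_el he heJ]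
  rfl

theorem CoindJ.ofV_mem_coindL (hV : ∀ v : V, act k v (1 : MonoidAlgebra k (MaxSubgroup he)) = v)
    (v : V) : CoindJ.ofV he heJ v ∈ (coindL k J.1 he V).toSubmodule :=
  Submodule.subset_span ⟨CoindJ.ofV he heJ v, el k e, by
    rw [CoindJ.ofV_act_el he heJ v hV, CoindJ.ofV_act_el he heJ v hV]⟩

include heJ in
-- The element `fye` records the value `f(ye)`, and every element of `A_J e` has the form `ye`. This
-- is dual to generation of `Ind_J(V)` by its `e`-part.
theorem CoindJ.resN_isTrivial (hV : ∀ v : V, act k v (1 : MonoidAlgebra k (MaxSubgroup he)) = v) :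
    (resN k (CoindJ k J.1 he V) e).IsTrivial := by
  intro f g h
  refine CoindJ.ext he fun z => ?_
  obtain ⟨_, y, rfl⟩ := z
  obtain ⟨y, rfl⟩ := toAJ_surjective k J.1 y
  have := h y
  rw [CoindJ.act_act_el he heJ, CoindJ.act_act_el he heJ] at this
  have := congrArg (fun f : CoindJ k J.1 he V => f.1 (AeOne k J he)) this
  rwa [CoindJ.ofV_one he heJ hV, CoindJ.ofV_one he heJ hV] at this

/-- A submodule that contains all `φ e` contains `Coind_J(V) e kS`. -/
theorem coindL_le (W : RSub k (MonoidAlgebra k S) (CoindJ k J.1 he V))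
    (hW : ∀ v, CoindJ.ofV he heJ v ∈ W.toSubmodule) : coindL k J.1 he V ≤ W := by
  refine Submodule.span_le.2 ?_
  rintro _ ⟨f, a, rfl⟩
  refine W.act_mem _ _ ?_
  rw [CoindJ.act_el he heJ]
  exact hW _

include heJ in
theorem CoindL.isGenerated (hV : ∀ v : V, act k v (1 : MonoidAlgebra k (MaxSubgroup he)) = v) :
    IsGenerated k (CoindL k J.1 he V) e := by
  intro W hW m
  have := coindL_le he heJ (W.map (Submodule.subtype _) fun _ _ => rfl) (fun v =>
    ⟨_, hW ⟨_, CoindJ.ofV_mem_coindL he heJ hV v⟩, CoindJ.ofV_act_el he heJ v hV⟩) m.2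
  obtain ⟨m', hm', h⟩ := this
  rwa [← Subtype.ext h]

include heJ in
theorem CoindL.resE_isomorphic (hV : ∀ v : V, act k v (1 : MonoidAlgebra k (MaxSubgroup he)) = v) :
    Isomorphic k (MonoidAlgebra k (MaxSubgroup he)) (resE k e (CoindL k J.1 he V)) V := by
  let g₀ : V →ₗ[k] CoindL k J.1 he V :=
    (CoindJ.ofV he heJ).codRestrict _ (CoindJ.ofV_mem_coindL he heJ hV)
  let g : V →ₗ[k] resE k e (CoindL k J.1 he V) :=
    g₀.codRestrict _ (fun v => ⟨g₀ v, Subtype.ext (CoindJ.ofV_act_el he heJ v hV)⟩)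
  have hg : Function.Bijective g := by
    refine ⟨fun v v' h => ?_, fun m => ?_⟩
    · have := congrArg (fun m : resE k e (CoindL k J.1 he V) => m.1.1.1 (AeOne k J he)) h
      change (CoindJ.ofV he heJ v : CoindJ k J.1 he V).1 (AeOne k J he) =
        (CoindJ.ofV he heJ v' : CoindJ k J.1 he V).1 (AeOne k J he) at this
      rwa [CoindJ.ofV_one he heJ hV, CoindJ.ofV_one he heJ hV] at this
    · refine ⟨m.1.1.1 (AeOne k J he), ?_⟩
      refine Eq.trans (b := toResE k _ e m.1) ?_ (toResE_coe he m)
      exact Subtype.ext (Subtype.ext (CoindJ.act_el he heJ m.1.1).symm)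
  exact Isomorphic.symm ⟨LinearEquiv.ofBijective g hg, fun v b =>
    Subtype.ext (Subtype.ext (CoindJ.ofV_act he heJ v b).symm)⟩

include heJ in
theorem CoindL.isIrreducibleModule
    (hV : IsIrreducibleModule k (MonoidAlgebra k (MaxSubgroup he)) V) :
    IsIrreducibleModule k (MonoidAlgebra k S) (CoindL k J.1 he V) ∧
      HasApex k (CoindL k J.1 he V) J ∧
      Isomorphic k (MonoidAlgebra k (MaxSubgroup he)) (resE k e (CoindL k J.1 he V)) V := by
  have hu := hV.2.act_one
  have i := CoindL.resE_isomorphic he heJ hu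
  have hV' := hV.congr i.symm
  refine ⟨isIrreducibleModule_of_resE he (CoindL.isGenerated he heJ hu) (fun f g h => ?_) hV',
    (CoindL.isKilled he).hasApex he heJ hV'.1.1, i⟩
  exact Subtype.ext (CoindJ.resN_isTrivial he heJ hu _ _ fun a => congrArg Subtype.val (h a))

include heJ in
theorem minimal_iff_eq_coindL (hV : IsMinimalModule k (MonoidAlgebra k (MaxSubgroup he)) V)
    (W : RSub k (MonoidAlgebra k S) (CoindJ k J.1 he V)) :
    Minimal RSub.IsNonzero W ↔ W = coindL k J.1 he V := by
  have hu := hV.act_one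
  have hle : ∀ W : RSub k (MonoidAlgebra k S) (CoindJ k J.1 he V), W.IsNonzero →
      coindL k J.1 he V ≤ W := by
    intro W hW
    obtain ⟨f, hf, hf0⟩ := (Submodule.ne_bot_iff _).1 hW
    have : ∃ y : MonoidAlgebra k S, act k (act k f y) (el k e) ≠ 0 := by
      by_contra! h0
      exact hf0 (CoindJ.resN_isTrivial he heJ hu _ _ (mem_resK_iff.1 h0))
    obtain ⟨y, hy⟩ := this
    have hm := W.act_mem _ (el k e) (W.act_mem _ y hf)
    rw [CoindJ.act_act_el he heJ] at hm hy
    -- Only the value `v₀ = f(ye)` matters: its image lies in `W` and is nonzero, and `v₀` generates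
    -- the minimal module `V`, so `W` contains the whole copy of `V`.
    generalize f.1 _ = v₀ at hm hy
    refine coindL_le he heJ W fun v => ?_
    obtain ⟨b, rfl⟩ := hV.exists_act_eq (m := v₀) (fun h => hy (by rw [h, map_zero])) v
    rw [← CoindJ.ofV_act he heJ]
    exact W.act_mem _ _ hm
  have hL : (coindL k J.1 he V).IsNonzero := by
    obtain ⟨v, hv⟩ := hV.1.exists_ne_zero
    refine (Submodule.ne_bot_iff _).2 ⟨_, CoindJ.ofV_mem_coindL he heJ hu v, fun h => hv ?_⟩
    rw [← CoindJ.ofV_one he heJ hu v, h]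
    rfl
  constructor
  · intro h
    exact RSub.le_antisymm (h.2 hL (hle W h.1)) (hle W h.1)
  · rintro rfl
    exact ⟨hL, fun W hW _ => hle W hW⟩

include heJ in
-- Both modules are irreducible with apex `J` and `e`-part `V`, so each is isomorphic to
-- `Ind_J(V)/N`.
theorem CoindL.isomorphic (hV : IsIrreducibleModule k (MonoidAlgebra k (MaxSubgroup he)) V)
    (hM : IsIrreducibleModule k (MonoidAlgebra k S) M) (hJ : HasApex k M J)
    (i : Isomorphic k (MonoidAlgebra k (MaxSubgroup he)) (resE k e M) V) :
    Isomorphic k (MonoidAlgebra k S) M (CoindL k J.1 he V) := by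
  obtain ⟨h1, h2, h3⟩ := CoindL.isIrreducibleModule he heJ hV
  exact (IndModN.isomorphic he heJ hV hM hJ i).trans (IndModN.isomorphic he heJ hV h1 h2 h3).symm

end Coinduction

/-! ### Existence and uniqueness of the apex -/

section Apex

theorem HasApex.unique {k : Type*} [CommSemiring k] {S : Type*} [Semigroup S] {M : Type*}
    [AddCommMonoid M] [Module k M] [RightModule k (MonoidAlgebra k S) M] {J J' : RegJClass S}
    (h : HasApex k M J) (h' : HasApex k M J') : J = J' :=
  RegJClass.notAbove_injective (Eq.trans (Eq.symm h) h')

variable {k : Type*} [CommSemiring k] {S : Type*} [Semigroup S] [Finite S]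
variable {M : Type*} [AddCommMonoid M] [Module k M] [RightModule k (MonoidAlgebra k S) M]

theorem IsMinimalModule.exists_hasApex (h : IsMinimalModule k (MonoidAlgebra k S) M) :
    ∃ J : RegJClass S, HasApex k M J := by
  let I : Set S := {s | ∀ m : M, act k m (el k s) = 0}
  have hI : ∀ {s t : S}, s ∈ I → t ∈ principalIdeal s → t ∈ I := by
    rintro s t hs ⟨p, q, h⟩ m
    induction p using WithOne.recOneCoe with
    | one =>
      induction q using WithOne.recOneCoe with
      | one =>
        rw [one_mul, mul_one, WithOne.coe_inj] at h
        rw [h, hs]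
      | coe q =>
        rw [one_mul, ← WithOne.coe_mul, WithOne.coe_inj] at h
        rw [h, ← el_mul_el, act_mul, hs, zero_act]
    | coe p =>
      induction q using WithOne.recOneCoe with
      | one =>
        rw [mul_one, ← WithOne.coe_mul, WithOne.coe_inj] at h
        rw [h, ← el_mul_el, act_mul, hs]
      | coe q =>
        rw [← WithOne.coe_mul, ← WithOne.coe_mul, WithOne.coe_inj] at h
        rw [h, ← el_mul_el, ← el_mul_el, act_mul, act_mul, hs (act k m (el k p)), zero_act]
  have hne : Set.Nonempty Iᶜ := by
    by_contra! hI
    obtain ⟨m, a, h0⟩ := h.1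
    refine h0 ?_
    clear h0
    induction a using MonoidAlgebra.induction_linear with
    | zero => rw [act_zero]
    | add f g hf hg => rw [act_add, hf, hg, add_zero]
    | single s c =>
      have : s ∈ I := by
        have : s ∉ Iᶜ := by rw [hI]; exact id
        simpa using this
      rw [single_eq_smul_el, act_smul, this, smul_zero]
  -- A non-annihilating `s` with smallest principal ideal: any `t ∈ J(s)` outside the annihilator
  -- `I` is then `𝒥`-equivalent to `s`. Its class will be the apex.
  obtain ⟨s, hs, hmin⟩ := Set.exists_min_image Iᶜ (fun s => (principalIdeal s).ncard)
    (Set.toFinite _) hne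
  have hJ : ∀ t ∈ principalIdeal s, t ∉ I → JRel s t := fun t ht htI =>
    (Set.eq_of_subset_of_ncard_le (principalIdeal_subset ht) (hmin t htI) (Set.toFinite _)).symm
  -- The elements killed by the ideal `J(s)` form a submodule, which is not everything because `Ms ≠
  -- 0`; by minimality it is zero.
  have hT : ∀ m : M, m ≠ 0 → ∃ t ∈ principalIdeal s, act k m (el k t) ≠ 0 := by
    intro m hm
    by_contra! hz
    let Z : RSub k (MonoidAlgebra k S) M :=
      { carrier := {m | ∀ t ∈ principalIdeal s, act k m (el k t) = 0}
        add_mem' := fun h h' t ht => by rw [add_act, h t ht, h' t ht, add_zero]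
        zero_mem' := fun _ _ => zero_act _
        smul_mem' := fun c m h t ht => by rw [smul_act, h t ht, smul_zero]
        act_mem := fun m a h t ht => by
          induction a using MonoidAlgebra.induction_linear with
          | zero => rw [act_zero, zero_act]
          | add f g hf hg => rw [act_add, add_act, hf, hg, add_zero]
          | single r c =>
            rw [single_eq_smul_el, act_smul, smul_act, ← act_mul, el_mul_el,
              h _ (principalIdeal_subset ht (principalIdeal_mul_left t r
                (self_mem_principalIdeal _))), smul_zero] }
    exact hs fun m' => h.eq_top Z (m := m) hz hm m' s (self_mem_principalIdeal s)
  have hsT : ∀ s' ∉ I, ∃ t ∈ principalIdeal s, s' * t ∉ I := by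
    intro s' hs'
    obtain ⟨m, hm⟩ := not_forall.1 hs'
    obtain ⟨t, ht, h0⟩ := hT _ hm
    rw [← act_mul, el_mul_el] at h0
    exact ⟨t, ht, fun h => h0 (h m)⟩
  have hmulr : ∀ a b : S, a * b ∈ principalIdeal b := fun a b =>
    principalIdeal_mul_left b a (self_mem_principalIdeal _)
  have hmull : ∀ a b : S, a * b ∈ principalIdeal a := fun a b =>
    principalIdeal_mul_right a b (self_mem_principalIdeal _)
  obtain ⟨t, ht, hst⟩ := hsT s hs
  obtain ⟨f, hf, hid⟩ := exists_idempotent_jRel (hJ t ht fun h => hst (hI h (hmulr s t)))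
    (hJ _ (hmull s t) hst)
  let J : RegJClass S := ⟨{t | JRel s t}, ⟨s, rfl⟩, f, hf, hid⟩
  have hsJ : s ∈ J.1 := rfl
  refine ⟨J, Set.ext fun s' => ?_⟩
  rw [RegJClass.mem_notAbove_iff hsJ]
  refine ⟨fun h h' => hs (hI h h'), fun h => ?_⟩
  by_contra hs'
  -- Any `s'` outside `I` lies above `s`: some `s't` with `t ∈ J(s)` is again outside `I`, so it is
  -- `𝒥`-equivalent to `s`.
  obtain ⟨t, ht, h'⟩ := hsT s' hs'
  have := hJ _ (principalIdeal_subset ht (hmulr s' t)) h'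
  apply h
  refine principalIdeal_subset (hmull s' t) ?_
  rw [← show principalIdeal s = _ from this]
  exact self_mem_principalIdeal s

end Apex

/-! ### The bijection on isomorphism classes -/

section Bijection

theorem isoClass_eq_iff {k : Type u} [CommSemiring k] {A : Type v} [NonUnitalSemiring A]
    [Module k A] {M N : Type w} [AddCommMonoid M] [Module k M] [RightModule k A M]
    [AddCommMonoid N] [Module k N] [RightModule k A N] :
    isoClass k A M = isoClass k A N ↔ Isomorphic k A M N :=
  ⟨fun h => Quotient.exact h, fun h => Quotient.sound h⟩

variable {k : Type u} [CommSemiring k] {S : Type v} [Semigroup S] [Finite S]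
  {e : RegJClass S → S} (he : ∀ J, IsIdempotentElem (e J)) (heJ : ∀ J, e J ∈ J.1)

/-- The map `(J, V) ↦ Ind_J(V) / N` on isomorphism classes. -/
def indClass (p : Σ J : RegJClass S,
      IrrClass.{u, max u v, max u v w} k (MonoidAlgebra k (MaxSubgroup (he J)))) :
    IrrClass.{u, max u v, max u v w} k (MonoidAlgebra k S) :=
  irrClass k (MonoidAlgebra k S) (IndModN k p.1.1 (he p.1) p.2.2.choose.carrier)
    (IndModN.isIrreducibleModule (he p.1) (heJ p.1) p.2.2.choose_spec.1).1

/-- Independence of the chosen representative: the quotient built from it has `e`-part isomorphic to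
`V`, so uniqueness applies. -/
theorem indClass_eq (J : RegJClass S) (V : Type (max u v w)) [AddCommMonoid V] [Module k V]
    [RightModule k (MonoidAlgebra k (MaxSubgroup (he J))) V]
    (hV : IsIrreducibleModule k (MonoidAlgebra k (MaxSubgroup (he J))) V) :
    (indClass.{u, v, w} he heJ ⟨J, irrClass k (MonoidAlgebra k (MaxSubgroup (he J))) V hV⟩).1 =
      isoClass k (MonoidAlgebra k S) (IndModN k J.1 (he J) V) := by
  have hc := (irrClass k (MonoidAlgebra k (MaxSubgroup (he J))) V hV).2.choose_spec
  obtain ⟨h1, h2, h3⟩ := IndModN.isIrreducibleModule (he J) (heJ J) hc.1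
  exact isoClass_eq_iff.2 (IndModN.isomorphic (he J) (heJ J) hV h1 h2
    (h3.trans (isoClass_eq_iff.1 hc.2)))

theorem IrrClass.exists_eq {A : Type v} [NonUnitalSemiring A] [Module k A]
    (c : IrrClass.{u, v, w} k A) : ∃ (M : RMod.{u, v, w} k A)
      (h : IsIrreducibleModule k A M.carrier), c = irrClass k A M.carrier h := by
  obtain ⟨c, M, h, rfl⟩ := c
  exact ⟨M, h, rfl⟩

/-- The pair is recovered from the module: `J` as its apex and `V` as its `e`-part. Every
irreducible `M` has an apex `J` and is the quotient attached to `Me`. -/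
theorem indClass_bijective : Function.Bijective (indClass.{u, v, w} (k := k) he heJ) := by
  constructor
  · rintro ⟨J, c⟩ ⟨J', c'⟩ h
    obtain ⟨V, hV, rfl⟩ := c.exists_eq
    obtain ⟨V', hV', rfl⟩ := c'.exists_eq
    have h := congrArg Subtype.val h
    rw [indClass_eq, indClass_eq, isoClass_eq_iff] at h
    obtain ⟨-, h2, h3⟩ := IndModN.isIrreducibleModule (he J) (heJ J) hV
    obtain ⟨-, h2', h3'⟩ := IndModN.isIrreducibleModule (he J') (heJ J') hV'
    obtain rfl := (h2.congr h).unique h2'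
    refine Sigma.ext rfl (heq_of_eq (Subtype.ext ?_))
    exact isoClass_eq_iff.2 (h3.symm.trans ((h.resE (he J)).trans h3'))
  · intro c
    obtain ⟨M, hM, rfl⟩ := c.exists_eq
    obtain ⟨J, hJ⟩ := hM.2.exists_hasApex
    have hV := hM.resE (he J) (heJ J) hJ
    refine ⟨⟨J, irrClass k _ (resE k (e J) M.carrier) hV⟩, Subtype.ext ?_⟩
    rw [indClass_eq]
    exact isoClass_eq_iff.2 (IndModN.isomorphic (he J) (heJ J) hV hM hJ Isomorphic.refl).symm

end Bijection

end

end SemiringRep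

theorem mainTheorem1 (k : Type u) [CommSemiring k] (S : Type v) [Semigroup S] [Finite S]
    (e : RegJClass S → S) (he : ∀ J, IsIdempotentElem (e J)) (heJ : ∀ J, e J ∈ J.1) :
    -- restriction to `G_J`
    (∀ (J : RegJClass S) (M : Type x) [AddCommMonoid M] [Module k M]
      [RightModule k (MonoidAlgebra k S) M], HasApex k M J →
      (IsIrreducibleModule k (MonoidAlgebra k S) M →
        IsIrreducibleModule k (MonoidAlgebra k (MaxSubgroup (he J))) (resE k (e J) M)) ∧
      (IsMinimalModule k (MonoidAlgebra k S) M →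
        IsMinimalModule k (MonoidAlgebra k (MaxSubgroup (he J))) (resE k (e J) M))) ∧
    -- irreducible modules as quotients of `Ind_J(V)`
    (∀ (J : RegJClass S) (V : Type w) [AddCommMonoid V] [Module k V]
      [RightModule k (MonoidAlgebra k (MaxSubgroup (he J))) V],
      IsIrreducibleModule k (MonoidAlgebra k (MaxSubgroup (he J))) V →
      (∀ R : RCon k (MonoidAlgebra k S) (IndJ k J.1 (he J) V),
        Maximal RCon.IsProper R ↔ R = indN k J.1 (he J) V) ∧
      IsIrreducibleModule k (MonoidAlgebra k S) (IndModN k J.1 (he J) V) ∧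
      HasApex k (IndModN k J.1 (he J) V) J ∧
      Isomorphic k (MonoidAlgebra k (MaxSubgroup (he J)))
        (resE k (e J) (IndModN k J.1 (he J) V)) V ∧
      (∀ (M : Type x) [AddCommMonoid M] [Module k M] [RightModule k (MonoidAlgebra k S) M],
        IsIrreducibleModule k (MonoidAlgebra k S) M → HasApex k M J →
        Isomorphic k (MonoidAlgebra k (MaxSubgroup (he J))) (resE k (e J) M) V →
        Isomorphic k (MonoidAlgebra k S) M (IndModN k J.1 (he J) V))) ∧
    -- irreducible modules as submodules of `Coind_J(V)`
    (∀ (J : RegJClass S) (V : Type w) [AddCommMonoid V] [Module k V]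
      [RightModule k (MonoidAlgebra k (MaxSubgroup (he J))) V],
      IsIrreducibleModule k (MonoidAlgebra k (MaxSubgroup (he J))) V →
      (∀ W : RSub k (MonoidAlgebra k S) (CoindJ k J.1 (he J) V),
        Minimal RSub.IsNonzero W ↔ W = coindL k J.1 (he J) V) ∧
      IsIrreducibleModule k (MonoidAlgebra k S) (CoindL k J.1 (he J) V) ∧
      HasApex k (CoindL k J.1 (he J) V) J ∧
      Isomorphic k (MonoidAlgebra k (MaxSubgroup (he J)))
        (resE k (e J) (CoindL k J.1 (he J) V)) V ∧
      (∀ (M : Type x) [AddCommMonoid M] [Module k M] [RightModule k (MonoidAlgebra k S) M],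
        IsIrreducibleModule k (MonoidAlgebra k S) M → HasApex k M J →
        Isomorphic k (MonoidAlgebra k (MaxSubgroup (he J))) (resE k (e J) M) V →
        Isomorphic k (MonoidAlgebra k S) M (CoindL k J.1 (he J) V))) ∧
    -- minimal modules as quotients of `Ind_J(V)`
    (∀ (J : RegJClass S) (V : Type w) [AddCommMonoid V] [Module k V]
      [RightModule k (MonoidAlgebra k (MaxSubgroup (he J))) V],
      IsMinimalModule k (MonoidAlgebra k (MaxSubgroup (he J))) V →
      (∀ W : RSub k (MonoidAlgebra k S) (IndJ k J.1 (he J) V),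
        Maximal RSub.IsProper W ↔ W = indK k J.1 (he J) V) ∧
      (∀ (M : Type x) [AddCommMonoid M] [Module k M] [RightModule k (MonoidAlgebra k S) M],
        (IsMinimalModule k (MonoidAlgebra k S) M ∧ HasApex k M J ∧
          Isomorphic k (MonoidAlgebra k (MaxSubgroup (he J))) (resE k (e J) M) V) ↔
        ∃ R : RCon k (MonoidAlgebra k S) (IndJ k J.1 (he J) V),
          R ≤ indN k J.1 (he J) V ∧
          (∀ p ∈ (indK k J.1 (he J) V).toSubmodule, ∀ q ∈ (indK k J.1 (he J) V).toSubmodule,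
            R.r p q) ∧
          Isomorphic k (MonoidAlgebra k S) M R.toModuleCon.Quotient)) ∧
    -- the resulting bijection
    (∃ Φ : (Σ J : RegJClass S,
          IrrClass.{u, max u v, max u v w} k (MonoidAlgebra k (MaxSubgroup (he J)))) ≃
        IrrClass.{u, max u v, max u v w} k (MonoidAlgebra k S),
      ∀ (J : RegJClass S) (V : Type (max u v w)) [AddCommMonoid V] [Module k V]
        [RightModule k (MonoidAlgebra k (MaxSubgroup (he J))) V]
        (hV : IsIrreducibleModule k (MonoidAlgebra k (MaxSubgroup (he J))) V),
        (Φ ⟨J, irrClass k (MonoidAlgebra k (MaxSubgroup (he J))) V hV⟩).1 =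
          isoClass k (MonoidAlgebra k S) (IndModN k J.1 (he J) V) ∧
        (Φ ⟨J, irrClass k (MonoidAlgebra k (MaxSubgroup (he J))) V hV⟩).1 =
          isoClass k (MonoidAlgebra k S) (CoindL k J.1 (he J) V)) := by
  refine ⟨fun J M _ _ _ hJ => ⟨fun h => h.resE (he J) (heJ J) hJ, fun h => h.resE (he J) (heJ J) hJ⟩,
    fun J V _ _ _ hV => ?_, fun J V _ _ _ hV => ?_, fun J V _ _ _ hV => ?_,
    Equiv.ofBijective _ (indClass_bijective.{u, v, w} he heJ), fun J V _ _ _ hV => ?_⟩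
  · have i := IndJ.resE_isomorphic (he J) (heJ J) hV.2.act_one
    obtain ⟨h1, h2, h3⟩ := IndModN.isIrreducibleModule (he J) (heJ J) hV
    refine ⟨fun R => ?_, h1, h2, h3,
      fun M _ _ _ hM hJ i => IndModN.isomorphic (he J) (heJ J) hV hM hJ i⟩
    rw [indN_eq_resN]
    exact maximal_iff_eq_resN (he J) (IndJ.isGenerated (he J)) (hV.congr i.symm).1 R
  · obtain ⟨h1, h2, h3⟩ := CoindL.isIrreducibleModule (he J) (heJ J) hV
    exact ⟨minimal_iff_eq_coindL (he J) (heJ J) hV.2, h1, h2, h3,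
      fun M _ _ _ hM hJ i => CoindL.isomorphic (he J) (heJ J) hV hM hJ i⟩
  · refine ⟨fun W => ?_, fun M _ _ _ =>
      isMinimalModule_iff_exists_quotient_indJ (he J) (heJ J) hV⟩
    rw [indK_eq_resK]
    exact maximal_iff_eq_resK (he J) (IndJ.isGenerated (he J))
      (hV.congr (IndJ.resE_isomorphic (he J) (heJ J) hV.act_one).symm) W
  · obtain ⟨h1, h2, h3⟩ := CoindL.isIrreducibleModule (he J) (heJ J) hV
    refine ⟨indClass_eq he heJ J V hV, (indClass_eq he heJ J V hV).trans ?_⟩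
    exact isoClass_eq_iff.2 (IndModN.isomorphic (he J) (heJ J) hV h1 h2 h3).symm
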